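/- Fix a local dimension $d\ge1$, a degree bound $z$, a gap $\Delta>0$, and constants $c\ge1$, $p,q\ge0$. Consider any finite connected graph $G=(\mathcal V,\mathcal E)$ of maximal degree at most $z$, with $N=|\mathcal V|$ vertices and $K=|\mathcal E|$ edges, a $d$-level spin at each vertex, and a Hamiltonian $H=\sum_{e\in\mathcal E}h_e$, where each $h_e$ is self-adjoint, acts non-trivially only on the two endpoints of $e$, and satisfies $\|h_e\|\le1$. Let $E_0$ be the smallest eigenvalue of $H$ and $P$ the ground state projector, i.e. the orthogonal projection onto the eigenspace of $E_0$. Suppose that * (gap) every eigenvalue of $H$ other than $E_0$ is at least $E_0+\Delta$; * (polynomial density of states) for every $E\ge0$, the number of eigenvalues of $H$, counted with multiplicity, in $[E_0,E_0+E]$ is at most $(cN)^{pE+q}$. *Trotter/compression construction.* Choose any ordering $e_1,\dots,e_K$ of the edges. For $\beta\ge0$ and integers $M\ge1$, $L\ge0$ put $x_e=e^{-\beta h_e/2M}-1$ and let $(g_1,\dots,g_{2K})=(e_K,\dots,e_1,e_1,\dots,e_K)$. With $\tau=\prod_{i=1}^K e^{-\beta h_{e_i}/2M}$ one has $(\tau^\dagger\tau)^M=\prod_{j=1}^M\prod_{i=1}^{2K}(1+x_{g_i})=\sum_\lambda\prod_{j=1}^M\prod_{i=1}^{2K}x_{g_i}^{\lambda_{j,i}}$,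 the sum running over all $M\times 2K$ matrices $\lambda$ with entries in $\{0,1\}$. The compressed operator $\tilde\rho_{\beta,M,L}$ is the part of this sum in which every column of $\lambda$ has at most $L$ ones. A PEPO of bond dimension $D$ on $G$ is an operator of the form $\sum_{\alpha:\mathcal E\to\{1,\dots,D\}}\bigotimes_{v\in\mathcal V}X^v_{\alpha(e^v_1)\dots\alpha(e^v_{z(v)})}$, where $e^v_1,\dots,e^v_{z(v)}$ are the edges at $v$ and the $X^v$ are operators on the spin at $v$; a PEPS is a vector of the same form, with the $X^v$ vectors in $\mathbb C^d$. For $\varepsilon>0$, say that $(\beta,M,L,D)$ is *$\varepsilon$-good* for $H$ (and the chosen ordering) if 1. $\bigl\|e^{-\beta H}/\operatorname{tr}e^{-\beta H}-P/\operatorname{tr}P\bigr\|_1\le\varepsilon$; 2. $e^{\beta E_0}\tilde\rho_{\beta,M,L}$ is a PEPO of bond dimension $D$ on $G$, and $\bigl\|e^{\beta E_0}\tilde\rho_{\beta,M,L}-P\bigr\|_1\le\varepsilon$; 3. for some unit vector $\psi_0$ with $P\psi_0=\psi_0$ there is a PEPS $\phi$ of bond dimension $D$ on $G$ with $\|\phi\|=1$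 and $\|\phi-\psi_0\|\le\varepsilon$; and if the ground state is unique up to a phase, this holds for every such $\psi_0$. Then: (a) There is a constant $C>0$ depending only on $d,z,\Delta,c,p,q$ such that for all such $G$, $H$, all edge orderings and all $0<\varepsilon<1$ there is an $\varepsilon$-good $(\beta,M,L,D)$ with $$0\le\beta\le C\log(N/\varepsilon),\qquad D\le e^{C\log^2(N/\varepsilon)} .$$ (b) For all $a>0$ and $k\ge0$ there is a constant $C>0$ depending only on $d,z,\Delta,c,p,q,a,k$ such that for all such $G$, $H$, all edge orderings and all $\varepsilon\ge aN^{-k}$ there is an $\varepsilon$-good $(\beta,M,L,D)$ with $$0\le\beta\le C\log N,\qquad D\le N^{C\log N} .$$ -/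

import Mathlib

noncomputable section

/-- Operators on the Hilbert space `⨂_{v ∈ V} ℂ^d` of one `d`-level spin per vertex, written as
matrices in the product basis, which is labelled by the configurations `V → Fin d`. -/
abbrev SpinOp (V : Type*) (d : ℕ) : Type _ := Matrix (V → Fin d) (V → Fin d) ℂ

/-- Vectors of the Hilbert space `⨂_{v ∈ V} ℂ^d`, with its Hilbert space norm. -/
abbrev SpinVec (V : Type*) (d : ℕ) : Type _ := EuclideanSpace ℂ (V → Fin d)

/-- `A` acts non-trivially only on the spins in `s`: it is `B ⊗ 1` with `B` an operator on the
spins in `s` and `1` the identity on the remaining spins. -/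
def SpinOp.ActsOn {V : Type*} {d : ℕ} (s : Set V) (A : SpinOp V d) : Prop :=
  ∃ B : Matrix (s → Fin d) (s → Fin d) ℂ, ∀ σ τ : V → Fin d,
    ((∀ v, v ∉ s → σ v = τ v) → A σ τ = B (fun v => σ v) (fun v => τ v)) ∧
    ((∃ v, v ∉ s ∧ σ v ≠ τ v) → A σ τ = 0)

/-- Operator norm (largest singular value). -/
def operatorNorm {ι : Type*} [Fintype ι] [DecidableEq ι] (A : Matrix ι ι ℂ) : ℝ :=
  ‖Matrix.toEuclideanCLM (𝕜 := ℂ) A‖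

/-- Trace norm `tr (A† A)^{1/2}`: the sum of the square roots of the eigenvalues of `A† A`. -/
def traceNorm {ι : Type*} [Fintype ι] [DecidableEq ι] (A : Matrix ι ι ℂ) : ℝ :=
  ∑ i, Real.sqrt ((Matrix.isHermitian_conjTranspose_mul_self A).eigenvalues i)

/-- A family of two-body interactions along the edges of `G`: each term is self-adjoint, acts
only on the two endpoints of its edge, and has operator norm at most `1`. -/
structure EdgeInteraction {V : Type*} [Fintype V] [DecidableEq V] (G : SimpleGraph V)
    (d : ℕ) where
  term : G.edgeSet → SpinOp V d
  isHermitian : ∀ e, (term e).IsHermitian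
  actsOn : ∀ e : G.edgeSet, (term e).ActsOn {v | v ∈ (e : Sym2 V)}
  norm_le_one : ∀ e, operatorNorm (term e) ≤ 1

namespace EdgeInteraction

variable {V : Type*} [Fintype V] [DecidableEq V] {G : SimpleGraph V} [DecidableRel G.Adj]
  {d : ℕ} (h : EdgeInteraction G d)

/-- The Hamiltonian `H = ∑_e h_e`. -/
def hamiltonian : SpinOp V d := ∑ e : G.edgeSet, h.term e

theorem isHermitian_hamiltonian : h.hamiltonian.IsHermitian := by
  unfold hamiltonian Matrix.IsHermitian
  rw [Matrix.conjTranspose_sum]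
  exact Finset.sum_congr rfl fun e _ => h.isHermitian e

/-- The eigenvalues of `H`, listed with multiplicity. -/
def energy (i : V → Fin d) : ℝ := h.isHermitian_hamiltonian.eigenvalues i

/-- The ground state energy, i.e. the smallest eigenvalue of `H`. -/
def groundEnergy : ℝ := ⨅ i, h.energy i

/-- The eigenspace of `H` for its smallest eigenvalue. -/
def groundSpace : Submodule ℂ (SpinVec V d) :=
  Module.End.eigenspace (Matrix.toEuclideanLin h.hamiltonian) (h.groundEnergy : ℂ)

/-- The ground state projector: the orthogonal projection onto the ground space. -/
def groundProjector : SpinOp V d :=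
  (Matrix.toEuclideanCLM (𝕜 := ℂ)).symm h.groundSpace.starProjection

/-- All eigenvalues of `H` other than the smallest one exceed it by at least `Δ`. -/
def HasGap (Δ : ℝ) : Prop :=
  ∀ i, h.energy i = h.groundEnergy ∨ h.groundEnergy + Δ ≤ h.energy i

/-- Polynomial growth of the density of states: the number of eigenvalues (with multiplicity)
at energy at most `E` above the ground state energy is at most `(c N)^(p E + q)`. -/
def PolynomialDensityOfStates (c p q : ℝ) : Prop :=
  ∀ E : ℝ, 0 ≤ E →
    (Nat.card {i // h.energy i ≤ h.groundEnergy + E} : ℝ) ≤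
      (c * (Fintype.card V : ℝ)) ^ (p * E + q)

/-- The unnormalised Gibbs operator `e^{-βH}`. -/
def boltzmann (β : ℝ) : SpinOp V d := NormedSpace.exp (-(β : ℂ) • h.hamiltonian)

/-- The Gibbs state `e^{-βH} / tr e^{-βH}`. -/
def gibbs (β : ℝ) : SpinOp V d := (h.boltzmann β).trace⁻¹ • h.boltzmann β

/-- The small operators `x_e = e^{-β h_e / 2M} - 1` of the Trotter expansion. -/
def smallOp (β : ℝ) (M : ℕ) (e : G.edgeSet) : SpinOp V d :=
  NormedSpace.exp (-((β / (2 * M) : ℝ) : ℂ) • h.term e) - 1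

/-- Given an ordering `e_1, …, e_K` of the edges, the edges in the order `e_K, …, e_1, e_1, …, e_K`
in which they occur in `τ† τ`, where `τ = ∏_i e^{-β h_{e_i} / 2M}`. -/
def column {K : ℕ} (ord : Fin K ≃ G.edgeSet) : Fin (K + K) → G.edgeSet :=
  Fin.append (fun i => ord i.rev) (fun i => ord i)

/-- The compressed Trotter operator. Expanding `(τ† τ)^M = ∏_{j=1}^M ∏_{i=1}^{2K} (1 + x_i)` gives
a sum over all `M × 2K` tables `t` of zeros and ones; only those tables are kept that contain at
most `L` ones in each of the `2K` columns. -/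
def compressedTrotter {K : ℕ} (ord : Fin K ≃ G.edgeSet) (β : ℝ) (M L : ℕ) : SpinOp V d :=
  ∑ t : Fin M → Fin (K + K) → Bool with
      (∀ i, (Finset.univ.filter fun j => t j i = true).card ≤ L),
    (List.ofFn fun j =>
      (List.ofFn fun i => if t j i = true then h.smallOp β M (column ord i) else 1).prod).prod

end EdgeInteraction

/-- `A` is a PEPO on the graph `G` with bond dimension `D`:
`A = ∑_{α : E → {1,…,D}} ⨂_v X^v_{α(e_1^v) … α(e_{z(v)}^v)}`, where `X^v` depends only on the
values of `α` on the edges at `v` and acts on the spin `v` alone. -/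
def IsPEPO {V : Type*} [Fintype V] [DecidableEq V] (G : SimpleGraph V) [DecidableRel G.Adj]
    {d : ℕ} (D : ℕ) (A : SpinOp V d) : Prop :=
  ∃ X : (v : V) → ({e : G.edgeSet // v ∈ (e : Sym2 V)} → Fin D) → Matrix (Fin d) (Fin d) ℂ,
    ∀ σ τ : V → Fin d,
      A σ τ = ∑ α : G.edgeSet → Fin D, ∏ v, X v (fun e => α e.1) (σ v) (τ v)

/-- `ψ` is a PEPS on the graph `G` with bond dimension `D`. -/
def IsPEPS {V : Type*} [Fintype V] [DecidableEq V] (G : SimpleGraph V) [DecidableRel G.Adj]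
    {d : ℕ} (D : ℕ) (ψ : SpinVec V d) : Prop :=
  ∃ X : (v : V) → ({e : G.edgeSet // v ∈ (e : Sym2 V)} → Fin D) → Fin d → ℂ,
    ∀ σ : V → Fin d,
      ψ σ = ∑ α : G.edgeSet → Fin D, ∏ v, X v (fun e => α e.1) (σ v)

/-- `ψ` is within distance `ε` of a normalised PEPS on `G` with bond dimension `D`. -/
def ApproxByPEPS {V : Type*} [Fintype V] [DecidableEq V] (G : SimpleGraph V) [DecidableRel G.Adj]
    {d : ℕ} (D : ℕ) (ε : ℝ) (ψ : SpinVec V d) : Prop :=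
  ∃ φ : SpinVec V d, IsPEPS G D φ ∧ ‖φ‖ = 1 ∧ ‖φ - ψ‖ ≤ ε

/-- The Trotter/compression construction with inverse temperature `β`, `M` Trotter steps and
cut-off `L` approximates the ground state with error `ε` and bond dimension `D`:
* the Gibbs state at `β` is `ε`-close in trace norm to the normalised ground state projector;
* the compressed Trotter operator, rescaled by `e^{β E₀}`, is a PEPO of bond dimension `D` and
  is `ε`-close in trace norm to the ground state projector;
* some ground state is `ε`-close to a PEPS of bond dimension `D`, and, if the ground state is
  unique up to a phase, it is so for every choice of the phase. -/
def EdgeInteraction.GroundStateApproximation {V : Type*} [Fintype V] [DecidableEq V]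
    {G : SimpleGraph V} [DecidableRel G.Adj] {d : ℕ} (h : EdgeInteraction G d) {K : ℕ}
    (ord : Fin K ≃ G.edgeSet) (ε β : ℝ) (M L D : ℕ) : Prop :=
  traceNorm (h.gibbs β - h.groundProjector.trace⁻¹ • h.groundProjector) ≤ ε ∧
  IsPEPO G D ((Real.exp (β * h.groundEnergy) : ℂ) • h.compressedTrotter ord β M L) ∧
  traceNorm ((Real.exp (β * h.groundEnergy) : ℂ) • h.compressedTrotter ord β M L
    - h.groundProjector) ≤ ε ∧
  (∃ ψ ∈ h.groundSpace, ‖ψ‖ = 1 ∧ ApproxByPEPS G D ε ψ) ∧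
  (Module.finrank ℂ h.groundSpace = 1 →
    ∀ ψ ∈ h.groundSpace, ‖ψ‖ = 1 → ApproxByPEPS G D ε ψ)

end

/-! The gap and the density of states control the total weight of the excited states in
$e^{-\beta(H-E_0)}$. Levels are grouped into shells of width $\Delta$. The $m$-th shell has at most
$(cN)^{(2p\Delta+q)m}$ levels, each of weight at most $e^{-\beta\Delta m}$, so the total is a small
geometric series once $\beta$ is a large multiple of $\log(N/\varepsilon)$
(`EdgeInteraction.excitedWeight_le`). Hence the Gibbs state and $e^{-\beta(H-E_0)}$ are close to the
ground state projector in trace norm.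

The compressed Trotter operator must then be compared with $e^{-\beta H}$ with an error relative to
$\operatorname{tr}e^{-\beta H}$; a bound in operator norm would lose a factor exponential in $N$.
The tool is a Hölder inequality for products $\prod_j e^{-2sH}B_j$: their trace against a
contraction is at most $\operatorname{tr}e^{-2sMH}\prod_j\|B_j\|$. It is proved by complex
interpolation (`Matrix.norm_trace_exp_mul_list_prod_le`). Each Trotter row is written as
$e^{-2sH}B_j$; since the row agrees with $e^{-2sH}$ to first order, $B_j=1+O((sn)^2)$ for $n=2K$
columns, and a number $M$ of rows polynomial in $N/\varepsilon$ suffices.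

Tables with an overfull column are removed by inclusion–exclusion over the set $S$ of columns
required to be overfull (`sum_tableProduct_eq`). Columns outside $S$ are resummed to full
exponentials, so Hölder applies to every remaining term, and $S$ contributes at most $\theta^{|S|}$
up to a common factor, with $\theta=2^{-L}e^{O(\beta)}$. The total error is of order
$(1+\theta)^{2K}-1$, small for $L=O(\log(N/\varepsilon))$ (`norm_trace_mul_compressed_sub_le`).

For the bond dimension, each $x_e$ is a sum of $d^2$ product operators, so a term of the expansion
is a product operator fixed by two sparse labelled columns per edge. Taking these as bond indices
gives $D\le(1+Md^2)^{2L}$ (`EdgeInteraction.isPEPO_compressedTrotter`), which is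
$e^{O(\log^2(N/\varepsilon))}$. Finally, some column of the PEPO matrix, normalised, is a PEPS close
to a ground state, by averaging over the product basis (`EdgeInteraction.exists_approxByPEPS`). -/

noncomputable section

/-! ### Products of exponentials to second order -/

section ExpBounds

variable {𝔸 : Type*} [NormedRing 𝔸] [NormOneClass 𝔸] [NormedAlgebra ℂ 𝔸] [CompleteSpace 𝔸]

/-- The remainder of the exponential series is dominated by that of `exp ‖A‖`. -/
theorem norm_exp_sub_sum_le (A : 𝔸) (k : ℕ) :
    ‖NormedSpace.exp A - ∑ i ∈ Finset.range k, ((i.factorial : ℂ)⁻¹) • A ^ i‖ ≤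
      Real.exp ‖A‖ - ∑ i ∈ Finset.range k, ‖A‖ ^ i / i.factorial := by
  have h1 : HasSum (fun n : ℕ => ((n.factorial : ℂ)⁻¹) • A ^ n) (NormedSpace.exp A) :=
    NormedSpace.exp_series_hasSum_exp' (𝕂 := ℂ) A
  have h2 : HasSum (fun n : ℕ => ‖A‖ ^ n / n.factorial) (Real.exp ‖A‖) := by
    rw [Real.exp_eq_exp_ℝ]
    exact NormedSpace.expSeries_div_hasSum_exp ‖A‖
  have h1' := (hasSum_nat_add_iff' k).2 h1
  have h2' := (hasSum_nat_add_iff' k).2 h2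
  refine h1'.norm_le_of_bounded h2' fun n => ?_
  rw [norm_smul, norm_inv, Complex.norm_natCast, div_eq_inv_mul]
  gcongr
  exact norm_pow_le A _

theorem norm_exp_le_exp_norm (A : 𝔸) : ‖NormedSpace.exp A‖ ≤ Real.exp ‖A‖ := by
  simpa using norm_exp_sub_sum_le A 0

theorem norm_exp_sub_one_le_exp_norm (A : 𝔸) : ‖NormedSpace.exp A - 1‖ ≤ Real.exp ‖A‖ - 1 := by
  simpa using norm_exp_sub_sum_le A 1

theorem norm_exp_sub_one_sub_self_le (A : 𝔸) :
    ‖NormedSpace.exp A - 1 - A‖ ≤ Real.exp ‖A‖ - 1 - ‖A‖ := by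
  simpa [Finset.sum_range_succ, sub_sub] using norm_exp_sub_sum_le A 2

/-- A product of exponentials agrees with `1 + ∑ Aᵢ` up to second order. -/
theorem norm_prod_exp_sub_one_sub_sum_le (l : List 𝔸) :
    ‖(l.map NormedSpace.exp).prod - 1 - l.sum‖ ≤
      Real.exp (l.map norm).sum - 1 - (l.map norm).sum := by
  induction l with
  | nil => simp
  | cons A l ih =>
    set Q := (l.map NormedSpace.exp).prod
    set s := (l.map norm).sum
    have hs : ‖l.sum‖ ≤ s := by
      clear ih
      induction l with
      | nil => simp [s]
      | cons B l ih => simpa [s] using (norm_add_le _ _).trans (add_le_add_right ih _)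
    have hsplit : NormedSpace.exp A * Q - 1 - (A + l.sum) =
        NormedSpace.exp A * (Q - 1 - l.sum) + (NormedSpace.exp A - 1) * l.sum
          + (NormedSpace.exp A - 1 - A) := by noncomm_ring
    simp only [List.map_cons, List.prod_cons, List.sum_cons]
    rw [hsplit, Real.exp_add]
    calc _ ≤ ‖NormedSpace.exp A‖ * ‖Q - 1 - l.sum‖ + ‖NormedSpace.exp A - 1‖ * ‖l.sum‖
          + ‖NormedSpace.exp A - 1 - A‖ := by
            refine (norm_add_le _ _).trans ?_
            gcongr
            refine (norm_add_le _ _).trans ?_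
            gcongr <;> exact norm_mul_le _ _
      _ ≤ Real.exp ‖A‖ * (Real.exp s - 1 - s) + (Real.exp ‖A‖ - 1) * s
          + (Real.exp ‖A‖ - 1 - ‖A‖) := by
            gcongr
            · exact norm_exp_le_exp_norm A
            · have := Real.add_one_le_exp ‖A‖
              have := norm_nonneg A
              linarith
            · exact norm_exp_sub_one_le_exp_norm A
            · exact norm_exp_sub_one_sub_self_le A
      _ = _ := by ring

theorem norm_prod_exp_sub_one_sub_sum_le_sq (l : List 𝔸) {a : ℝ}
    (hl : (l.map norm).sum ≤ a) (ha : a ≤ 1) :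
    ‖(l.map NormedSpace.exp).prod - 1 - l.sum‖ ≤ a ^ 2 := by
  have h0 : 0 ≤ (l.map norm).sum := List.sum_nonneg (by simp)
  refine (norm_prod_exp_sub_one_sub_sum_le l).trans ?_
  have := Real.abs_exp_sub_one_sub_id_le (x := (l.map norm).sum)
    (by rw [abs_of_nonneg h0]; exact hl.trans ha)
  exact ((le_abs_self _).trans this).trans (by gcongr)

end ExpBounds

/-! ### Elementary operator norm and trace bounds -/

section MatrixBounds

open scoped Matrix.Norms.L2Operator

variable {ι : Type*} [Fintype ι] [DecidableEq ι]

theorem Matrix.norm_one_le : ‖(1 : Matrix ι ι ℂ)‖ ≤ 1 := by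
  rcases isEmpty_or_nonempty ι with h | h
  · rw [Subsingleton.elim (1 : Matrix ι ι ℂ) 0]; simp
  · exact norm_one.le

/-- The diagonal form `⟨x, A x⟩` is bounded by `‖A‖ ‖x‖²`. -/
theorem Matrix.norm_star_dotProduct_mulVec_le (A : Matrix ι ι ℂ) (x : ι → ℂ) :
    ‖star x ⬝ᵥ A.mulVec x‖ ≤ ‖A‖ * ∑ i, ‖x i‖ ^ 2 := by
  have h := norm_inner_le_norm (𝕜 := ℂ) (WithLp.toLp 2 x) (WithLp.toLp 2 (A.mulVec x))
  have h2 := Matrix.l2_opNorm_mulVec A (WithLp.toLp 2 x)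
  have h3 : ‖(WithLp.toLp 2 x : EuclideanSpace ℂ ι)‖ ^ 2 = ∑ i, ‖x i‖ ^ 2 :=
    EuclideanSpace.norm_sq_eq _
  have h4 : inner ℂ (WithLp.toLp 2 x : EuclideanSpace ℂ ι) (WithLp.toLp 2 (A.mulVec x)) =
      star x ⬝ᵥ A.mulVec x := by
    rw [EuclideanSpace.inner_toLp_toLp, dotProduct_comm]
  rw [h4] at h
  rw [← h3, sq, ← mul_assoc, mul_comm (‖A‖ * _)]
  exact h.trans (mul_le_mul_of_nonneg_left h2 (norm_nonneg _))

theorem Matrix.norm_diag_le (A : Matrix ι ι ℂ) (i : ι) : ‖A i i‖ ≤ ‖A‖ := by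
  have := A.norm_star_dotProduct_mulVec_le (Pi.single i 1)
  simpa [Pi.single_apply, Pi.star_def, apply_ite, dotProduct, Matrix.mulVec] using this

/-- `|tr (X X† B)| ≤ tr (X X†) ‖B‖`. -/
theorem Matrix.norm_trace_mul_conjTranspose_mul_le (X B : Matrix ι ι ℂ) :
    ‖(X * X.conjTranspose * B).trace‖ ≤ (X * X.conjTranspose).trace.re * ‖B‖ := by
  have h1 : (X * X.conjTranspose * B).trace = ∑ j, star (fun i => X i j) ⬝ᵥ
      B.mulVec (fun i => X i j) := by
    rw [Matrix.mul_assoc, Matrix.trace_mul_comm, Matrix.mul_assoc]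
    simp [Matrix.trace, Matrix.mul_apply, dotProduct, Matrix.mulVec]
  have h2 : (X * X.conjTranspose).trace.re = ∑ j, ∑ i, ‖X i j‖ ^ 2 := by
    rw [Finset.sum_comm]
    simp [Matrix.trace, Matrix.mul_apply, Complex.mul_conj, Complex.normSq_eq_norm_sq]
    norm_cast
  rw [h1, h2, Finset.sum_mul]
  refine (norm_sum_le _ _).trans (Finset.sum_le_sum fun j _ => ?_)
  rw [mul_comm]
  exact B.norm_star_dotProduct_mulVec_le _

end MatrixBounds

/-! ### Hölder's inequality by complex interpolation -/

section Hoelder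

open scoped Matrix.Norms.L2Operator

variable {ι : Type*} [Fintype ι] [DecidableEq ι] {H : Matrix ι ι ℂ}

theorem Matrix.exp_add_smul (H : Matrix ι ι ℂ) (z w : ℂ) :
    NormedSpace.exp ((z + w) • H) = NormedSpace.exp (z • H) * NormedSpace.exp (w • H) := by
  rw [add_smul, Matrix.exp_add_of_commute]
  exact ((Commute.refl H).smul_left z).smul_right w

theorem Matrix.exp_smul_I_mem_unitary (hH : H.IsHermitian) (y : ℝ) :
    NormedSpace.exp ((y * Complex.I : ℂ) • H) ∈ unitary (Matrix ι ι ℂ) := by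
  have h1 : star (NormedSpace.exp ((y * Complex.I : ℂ) • H)) =
      NormedSpace.exp ((-(y * Complex.I) : ℂ) • H) := by
    rw [Matrix.star_eq_conjTranspose, ← Matrix.exp_conjTranspose, Matrix.conjTranspose_smul, hH.eq]
    simp
  rw [Unitary.mem_iff, h1, ← Matrix.exp_add_smul, ← Matrix.exp_add_smul]
  simp

theorem Matrix.norm_le_one_of_mem_unitary {U : Matrix ι ι ℂ} (hU : U ∈ unitary (Matrix ι ι ℂ)) :
    ‖U‖ ≤ 1 := by
  have h := Matrix.norm_one_le (ι := ι)
  rw [← (Unitary.mem_iff.1 hU).1, CStarRing.norm_star_mul_self] at h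
  nlinarith [norm_nonneg U]

theorem Matrix.norm_exp_smul_I_le (hH : H.IsHermitian) (y : ℝ) :
    ‖NormedSpace.exp ((y * Complex.I : ℂ) • H)‖ ≤ 1 :=
  Matrix.norm_le_one_of_mem_unitary (Matrix.exp_smul_I_mem_unitary hH y)

/-- Exhibits the weight as $XX^\dagger$, the form in which positivity enters the trace bounds below.
-/
theorem Matrix.exp_real_smul_eq (hH : H.IsHermitian) (w : ℝ) :
    NormedSpace.exp ((w : ℂ) • H) = NormedSpace.exp (((w / 2 : ℝ) : ℂ) • H) *
      (NormedSpace.exp (((w / 2 : ℝ) : ℂ) • H)).conjTranspose := by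
  rw [← Matrix.exp_conjTranspose, Matrix.conjTranspose_smul, hH.eq, Complex.star_def,
    Complex.conj_ofReal, ← Matrix.exp_add_smul, ← Complex.ofReal_add, add_halves]

theorem Matrix.norm_trace_exp_mul_le (hH : H.IsHermitian) (w : ℝ) (B : Matrix ι ι ℂ) :
    ‖(NormedSpace.exp ((w : ℂ) • H) * B).trace‖ ≤
      (NormedSpace.exp ((w : ℂ) • H)).trace.re * ‖B‖ := by
  rw [Matrix.exp_real_smul_eq hH]
  exact Matrix.norm_trace_mul_conjTranspose_mul_le _ _

theorem Matrix.trace_exp_re_nonneg (hH : H.IsHermitian) (w : ℝ) :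
    0 ≤ (NormedSpace.exp ((w : ℂ) • H)).trace.re := by
  have h2 : (NormedSpace.exp ((w : ℂ) • H)).trace.re = ∑ i, ∑ j,
      ‖NormedSpace.exp (((w / 2 : ℝ) : ℂ) • H) i j‖ ^ 2 := by
    rw [Matrix.exp_real_smul_eq hH]
    simp [Matrix.trace, Matrix.mul_apply, Complex.mul_conj, Complex.normSq_eq_norm_sq]
    norm_cast
  rw [h2]
  positivity

theorem Matrix.norm_exp_smul_le [Nonempty ι] (hH : H.IsHermitian) (z : ℂ) :
    ‖NormedSpace.exp (z • H)‖ ≤ Real.exp (|z.re| * ‖H‖) := by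
  conv_lhs => rw [← Complex.re_add_im z, Matrix.exp_add_smul]
  refine (norm_mul_le _ _).trans ?_
  have h1 := Matrix.norm_exp_smul_I_le hH z.im
  have h2 := norm_exp_le_exp_norm ((z.re : ℂ) • H)
  rw [norm_smul, Complex.norm_real, Real.norm_eq_abs] at h2
  calc _ ≤ Real.exp (|z.re| * ‖H‖) * 1 := by gcongr
    _ = _ := mul_one _

theorem Matrix.norm_trace_le [Nonempty ι] (A : Matrix ι ι ℂ) :
    ‖A.trace‖ ≤ Fintype.card ι * ‖A‖ := by
  refine (norm_sum_le _ _).trans ?_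
  refine (Finset.sum_le_sum fun i _ => A.norm_diag_le i).trans ?_
  simp

/-- The maximum modulus step: a trace with weights `z` and `w - z` is bounded by its values
on the two edges of the strip. -/
theorem Matrix.norm_trace_exp_mul_exp_le [Nonempty ι] (hH : H.IsHermitian) {w C : ℝ} (hw : 0 ≤ w)
    (A B : Matrix ι ι ℂ)
    (h0 : ∀ y : ℝ, ‖(NormedSpace.exp ((y * Complex.I : ℂ) • H) * A *
      NormedSpace.exp ((w - y * Complex.I : ℂ) • H) * B).trace‖ ≤ C)
    (h1 : ∀ y : ℝ, ‖(NormedSpace.exp ((w + y * Complex.I : ℂ) • H) * A *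
      NormedSpace.exp ((-(y * Complex.I) : ℂ) • H) * B).trace‖ ≤ C)
    {v : ℝ} (hv0 : 0 ≤ v) (hvw : v ≤ w) :
    ‖(NormedSpace.exp ((v : ℂ) • H) * A *
      NormedSpace.exp (((w - v : ℝ) : ℂ) • H) * B).trace‖ ≤ C := by
  set f : ℂ → ℂ := fun z => (NormedSpace.exp (z • H) * A *
      NormedSpace.exp ((w - z : ℂ) • H) * B).trace with hf
  have hdiff : Differentiable ℂ f := by
    have e1 : Differentiable ℂ fun z : ℂ => NormedSpace.exp (z • H) := fun z =>
      (hasDerivAt_exp_smul_const H z).differentiableAt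
    have e2 : Differentiable ℂ fun z : ℂ => NormedSpace.exp ((w - z : ℂ) • H) :=
      e1.comp (by fun_prop : Differentiable ℂ fun z : ℂ => (w : ℂ) - z)
    have e3 : Differentiable ℂ fun z : ℂ => NormedSpace.exp (z • H) * A *
      NormedSpace.exp ((w - z : ℂ) • H) * B := ((e1.mul_const A).mul e2).mul_const B
    exact (LinearMap.toContinuousLinearMap
      (Matrix.traceLinearMap ι ℂ ℂ)).differentiable.comp e3
  have key := PhragmenLindelof.vertical_strip (a := 0) (b := w) (C := C) (f := f) (z := (v : ℂ))
    hdiff.diffContOnCl ?_ ?_ ?_ (by simpa using hv0) (by simpa using hvw)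
  · simpa [hf] using key
  · rcases hw.eq_or_lt with h | h
    · subst h
      -- For $w=0$ the open strip is empty and the growth rate must lie below $\pi/0=0$, so $-1$ is
      -- used; the growth condition itself is vacuous.
      refine ⟨-1, by simp, 0, ?_⟩
      simp only [Set.Ioo_self, Set.preimage_empty, Filter.principal_empty, inf_bot_eq]
      exact Asymptotics.isBigO_iff.2 ⟨0, by simp⟩
    refine ⟨0, by simp only [sub_zero]; positivity, 0, ?_⟩
    simp only [zero_mul, Real.exp_zero]
    refine Asymptotics.IsBigO.of_bound (Fintype.card ι *
      (Real.exp (w * ‖H‖) * ‖A‖ * Real.exp (w * ‖H‖) * ‖B‖)) ?_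
    refine Filter.eventually_inf_principal.2 (Filter.Eventually.of_forall fun z hz => ?_)
    simp only [Set.mem_preimage, Set.mem_Ioo] at hz
    simp only [norm_one, mul_one]
    refine (Matrix.norm_trace_le _).trans ?_
    have b1 : ‖NormedSpace.exp (z • H)‖ ≤ Real.exp (w * ‖H‖) := by
      refine (Matrix.norm_exp_smul_le hH z).trans ?_
      rw [abs_of_pos hz.1]
      gcongr
      exact hz.2.le
    have b2 : ‖NormedSpace.exp ((w - z : ℂ) • H)‖ ≤ Real.exp (w * ‖H‖) := by
      refine (Matrix.norm_exp_smul_le hH _).trans ?_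
      have : ((w : ℂ) - z).re = w - z.re := by simp
      rw [this, abs_of_pos (by linarith)]
      gcongr
      linarith
    gcongr
    refine (norm_mul_le _ _).trans ?_
    gcongr
    refine (norm_mul_le _ _).trans ?_
    gcongr
    refine (norm_mul_le _ _).trans ?_
    gcongr
  · intro z hz
    have : z = z.im * Complex.I := by
      conv_lhs => rw [← Complex.re_add_im z, hz]
      simp
    rw [hf, this]
    exact h0 z.im
  · intro z hz
    have : z = w + z.im * Complex.I := by
      conv_lhs => rw [← Complex.re_add_im z, hz]
    rw [hf, this]
    have := h1 z.im
    simpa using this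

/-- Hölder's inequality for a product of exponentials of one self-adjoint matrix, interlaced with
arbitrary matrices. -/
theorem Matrix.norm_trace_exp_mul_list_prod_le [Nonempty ι] (hH : H.IsHermitian)
    (l : List (ℝ × Matrix ι ι ℂ)) (hl : ∀ p ∈ l, 0 ≤ p.1) :
    ∀ (w : ℝ) (U T : Matrix ι ι ℂ), 0 ≤ w →
    ‖(NormedSpace.exp ((w : ℂ) • H) * U *
        (l.map fun p => NormedSpace.exp ((p.1 : ℂ) • H) * p.2).prod * T).trace‖ ≤
      (NormedSpace.exp (((w + (l.map Prod.fst).sum : ℝ) : ℂ) • H)).trace.re * ‖U‖ * ‖T‖ *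
        (l.map fun p => ‖p.2‖).prod := by
  induction l with
  | nil =>
    intro w U T hw
    simp only [List.map_nil, List.prod_nil, mul_one, List.sum_nil, add_zero]
    rw [Matrix.mul_assoc, mul_assoc]
    refine (Matrix.norm_trace_exp_mul_le hH w _).trans ?_
    have := Matrix.trace_exp_re_nonneg hH w
    gcongr
    exact norm_mul_le _ _
  | cons p l ih =>
    intro w U T hw
    obtain ⟨w2, B⟩ := p
    have hl' : ∀ p ∈ l, 0 ≤ p.1 := fun p hp => hl p (List.mem_cons_of_mem _ hp)
    have hw2 : 0 ≤ w2 := hl (w2, B) List.mem_cons_self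
    have ih := ih hl'
    simp only [List.map_cons, List.prod_cons, List.sum_cons]
    set W := (l.map fun p => NormedSpace.exp ((p.1 : ℂ) • H) * p.2).prod with hW
    set P := (l.map fun p => ‖p.2‖).prod with hP
    set Z := (NormedSpace.exp (((w + (w2 + (l.map Prod.fst).sum) : ℝ) : ℂ) • H)).trace.re with hZ
    have hPnn : 0 ≤ P := List.prod_nonneg fun a ha => by
      obtain ⟨p, -, rfl⟩ := List.mem_map.1 ha
      exact norm_nonneg _
    have hZnn : 0 ≤ Z := Matrix.trace_exp_re_nonneg hH _
    have hIy : ∀ y : ℝ, ‖NormedSpace.exp ((-(y * Complex.I) : ℂ) • H)‖ ≤ 1 := fun y => by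
      have := Matrix.norm_exp_smul_I_le hH (-y)
      rwa [Complex.ofReal_neg, neg_mul] at this
    -- The weights of the first two exponentials become $z$ and $w+w_2-z$. On either edge of the
    -- strip one of them is unitary and is absorbed into its neighbours (after a cyclic shift on the
    -- left edge), which leaves one exponential fewer and the induction hypothesis. The claim is the
    -- value at $z=w$.
    have key := Matrix.norm_trace_exp_mul_exp_le hH (w := w + w2)
      (C := Z * ‖U‖ * ‖T‖ * (‖B‖ * P)) (by positivity) U (B * W * T) ?_ ?_ hw (by linarith)
    · rw [add_sub_cancel_left] at key
      simpa only [Matrix.mul_assoc] using key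
    · intro y
      have := ih (w + w2) (NormedSpace.exp ((-(y * Complex.I) : ℂ) • H) * B)
        (T * (NormedSpace.exp ((y * Complex.I : ℂ) • H) * U)) (by positivity)
      rw [add_assoc w w2, ← hZ] at this
      have e : (NormedSpace.exp ((y * Complex.I : ℂ) • H) * U *
          NormedSpace.exp ((((w + w2 : ℝ) : ℂ) - y * Complex.I : ℂ) • H) * (B * W * T)).trace =
          (NormedSpace.exp (((w + w2 : ℝ) : ℂ) • H) *
            (NormedSpace.exp ((-(y * Complex.I) : ℂ) • H) * B) * W *
            (T * (NormedSpace.exp ((y * Complex.I : ℂ) • H) * U))).trace := by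
        rw [sub_eq_add_neg, Matrix.exp_add_smul, Matrix.mul_assoc (_ * U), Matrix.trace_mul_comm]
        simp only [Matrix.mul_assoc]
      rw [e]
      refine this.trans ?_
      calc _ ≤ Z * (1 * ‖B‖) * (‖T‖ * (1 * ‖U‖)) * P := by
            gcongr
            · exact (norm_mul_le _ _).trans (by gcongr; exact hIy y)
            · refine (norm_mul_le _ _).trans ?_
              gcongr
              exact (norm_mul_le _ _).trans (by gcongr; exact Matrix.norm_exp_smul_I_le hH y)
        _ = _ := by ring
    · intro y
      have := ih (w + w2) (NormedSpace.exp ((y * Complex.I : ℂ) • H) * U *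
        NormedSpace.exp ((-(y * Complex.I) : ℂ) • H) * B) T (by positivity)
      rw [add_assoc w w2, ← hZ] at this
      have e : (NormedSpace.exp ((((w + w2 : ℝ) : ℂ) + y * Complex.I : ℂ) • H) * U *
          NormedSpace.exp ((-(y * Complex.I) : ℂ) • H) * (B * W * T)).trace =
          (NormedSpace.exp (((w + w2 : ℝ) : ℂ) • H) *
            (NormedSpace.exp ((y * Complex.I : ℂ) • H) * U *
              NormedSpace.exp ((-(y * Complex.I) : ℂ) • H) * B) * W * T).trace := by
        rw [Matrix.exp_add_smul]
        simp only [Matrix.mul_assoc]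
      rw [e]
      refine this.trans ?_
      calc _ ≤ Z * (1 * ‖U‖ * 1 * ‖B‖) * ‖T‖ * P := by
            gcongr
            refine (norm_mul_le _ _).trans ?_
            gcongr
            refine (norm_mul_le _ _).trans ?_
            gcongr
            · exact (norm_mul_le _ _).trans (by gcongr; exact Matrix.norm_exp_smul_I_le hH y)
            · exact hIy y
        _ = _ := by ring

/-- Hölder's inequality in the form used for products of `M` rows `e^{wH} Bⱼ`. -/
theorem Matrix.norm_trace_mul_prod_exp_mul_le [Nonempty ι] (hH : H.IsHermitian) {w : ℝ}
    (hw : 0 ≤ w) (U : Matrix ι ι ℂ) (l : List (Matrix ι ι ℂ)) :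
    ‖(U * (l.map fun B => NormedSpace.exp ((w : ℂ) • H) * B).prod).trace‖ ≤
      (NormedSpace.exp (((l.length * w : ℝ) : ℂ) • H)).trace.re * ‖U‖ * (l.map norm).prod := by
  have h := Matrix.norm_trace_exp_mul_list_prod_le hH (l.map fun B => (w, B))
    (by simpa using fun _ _ => hw) 0 U 1 le_rfl
  have hs : (l.map fun _ => w).sum = l.length * w := by simp
  simpa [Function.comp_def, hs] using h

end Hoelder

/-! ### Spectral calculus and duality for the trace norm -/

section TraceNormDuality

open scoped Matrix.Norms.L2Operator

variable {ι : Type*} [Fintype ι] [DecidableEq ι]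

/-- The matrix `V diag(f) V†` in the eigenbasis of a Hermitian matrix. -/
def Matrix.IsHermitian.spectralMatrix {A : Matrix ι ι ℂ} (hA : A.IsHermitian) (f : ι → ℂ) :
    Matrix ι ι ℂ :=
  (hA.eigenvectorUnitary : Matrix ι ι ℂ) * Matrix.diagonal f *
    (hA.eigenvectorUnitary : Matrix ι ι ℂ).conjTranspose

namespace Matrix.IsHermitian

variable {A : Matrix ι ι ℂ} (hA : A.IsHermitian)

theorem eigenvectorUnitary_conjTranspose_mul :
    (hA.eigenvectorUnitary : Matrix ι ι ℂ).conjTranspose * hA.eigenvectorUnitary = 1 :=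
  Unitary.coe_star_mul_self hA.eigenvectorUnitary

theorem eigenvectorUnitary_mul_conjTranspose :
    (hA.eigenvectorUnitary : Matrix ι ι ℂ) *
      (hA.eigenvectorUnitary : Matrix ι ι ℂ).conjTranspose = 1 :=
  Unitary.coe_mul_star_self hA.eigenvectorUnitary

theorem spectralMatrix_mul (f g : ι → ℂ) :
    hA.spectralMatrix f * hA.spectralMatrix g = hA.spectralMatrix (f * g) := by
  unfold spectralMatrix
  calc _ = (hA.eigenvectorUnitary : Matrix ι ι ℂ) * Matrix.diagonal f *
        ((hA.eigenvectorUnitary : Matrix ι ι ℂ).conjTranspose * hA.eigenvectorUnitary) *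
        Matrix.diagonal g * (hA.eigenvectorUnitary : Matrix ι ι ℂ).conjTranspose := by
          simp only [Matrix.mul_assoc]
    _ = _ := by
      rw [eigenvectorUnitary_conjTranspose_mul, mul_one, Matrix.mul_assoc _ (diagonal f),
        Matrix.diagonal_mul_diagonal]
      rfl

theorem spectralMatrix_one : hA.spectralMatrix 1 = 1 := by
  unfold spectralMatrix
  rw [show (Matrix.diagonal (1 : ι → ℂ)) = 1 from Matrix.diagonal_one, mul_one,
    eigenvectorUnitary_mul_conjTranspose]

theorem spectralMatrix_sub (f g : ι → ℂ) :
    hA.spectralMatrix (f - g) = hA.spectralMatrix f - hA.spectralMatrix g := by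
  unfold spectralMatrix
  rw [← Matrix.sub_mul, ← Matrix.mul_sub, Matrix.diagonal_sub]
  rfl

theorem spectralMatrix_smul (c : ℂ) (f : ι → ℂ) :
    hA.spectralMatrix (c • f) = c • hA.spectralMatrix f := by
  unfold spectralMatrix
  rw [Matrix.diagonal_smul, Matrix.mul_smul, Matrix.smul_mul]

theorem spectralMatrix_conjTranspose (f : ι → ℂ) :
    (hA.spectralMatrix f).conjTranspose = hA.spectralMatrix (star f) := by
  unfold spectralMatrix
  simp [Matrix.conjTranspose_mul, Matrix.diagonal_conjTranspose, Matrix.mul_assoc]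

theorem spectralMatrix_eigenvalues :
    hA.spectralMatrix (fun i => (hA.eigenvalues i : ℂ)) = A :=
  hA.spectral_theorem.symm

theorem trace_spectralMatrix (f : ι → ℂ) : (hA.spectralMatrix f).trace = ∑ i, f i := by
  unfold spectralMatrix
  rw [Matrix.trace_mul_comm, ← Matrix.mul_assoc, eigenvectorUnitary_conjTranspose_mul, one_mul,
    Matrix.trace_diagonal]

theorem exp_smul_eq_spectralMatrix (z : ℂ) :
    NormedSpace.exp (z • A) = hA.spectralMatrix fun i => Complex.exp (z * hA.eigenvalues i) := by
  have hu : IsUnit (hA.eigenvectorUnitary : Matrix ι ι ℂ) :=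
    ⟨⟨_, _, hA.eigenvectorUnitary_mul_conjTranspose, hA.eigenvectorUnitary_conjTranspose_mul⟩, rfl⟩
  have hinv : (hA.eigenvectorUnitary : Matrix ι ι ℂ)⁻¹ =
      (hA.eigenvectorUnitary : Matrix ι ι ℂ).conjTranspose :=
    Matrix.inv_eq_right_inv hA.eigenvectorUnitary_mul_conjTranspose
  have h := Matrix.exp_conj (hA.eigenvectorUnitary : Matrix ι ι ℂ)
    (Matrix.diagonal (z • fun i => (hA.eigenvalues i : ℂ))) hu
  rw [hinv, Matrix.exp_diagonal] at h
  have h2 := hA.spectralMatrix_smul z (fun i => (hA.eigenvalues i : ℂ))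
  rw [spectralMatrix_eigenvalues] at h2
  rw [← h2, spectralMatrix, h, spectralMatrix]
  congr 3
  funext i
  rw [Pi.coe_exp, ← Complex.exp_eq_exp_ℂ]
  rfl

theorem norm_eigenvectorUnitary_le : ‖(hA.eigenvectorUnitary : Matrix ι ι ℂ)‖ ≤ 1 :=
  Matrix.norm_le_one_of_mem_unitary hA.eigenvectorUnitary.2

/-- In the eigenbasis the trace only sees the diagonal entries of the conjugated `U`, each at most
`‖U‖`. Together with `traceNorm_le_of_forall` this bounds trace norms of functions of $H$. -/
theorem norm_trace_mul_spectralMatrix_le (U : Matrix ι ι ℂ) (f : ι → ℂ) :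
    ‖(U * hA.spectralMatrix f).trace‖ ≤ ‖U‖ * ∑ i, ‖f i‖ := by
  set V := (hA.eigenvectorUnitary : Matrix ι ι ℂ) with hV
  have h1 : (U * hA.spectralMatrix f).trace = ∑ i, (V.conjTranspose * U * V) i i * f i := by
    rw [spectralMatrix, ← Matrix.mul_assoc, Matrix.trace_mul_comm, ← hV]
    simp only [← Matrix.mul_assoc]
    simp only [Matrix.trace, Matrix.diag_apply, Matrix.mul_diagonal]
  rw [h1, Finset.mul_sum]
  refine (norm_sum_le _ _).trans (Finset.sum_le_sum fun i _ => ?_)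
  rw [norm_mul]
  gcongr
  refine (Matrix.norm_diag_le _ i).trans ?_
  have hv : ‖V‖ ≤ 1 := hA.norm_eigenvectorUnitary_le
  have hv' : ‖V.conjTranspose‖ ≤ 1 := by rwa [Matrix.l2_opNorm_conjTranspose]
  calc _ ≤ ‖V.conjTranspose‖ * ‖U‖ * ‖V‖ :=
        (norm_mul_le _ _).trans (by gcongr; exact norm_mul_le _ _)
    _ ≤ 1 * ‖U‖ * 1 := by gcongr
    _ = _ := by ring

end Matrix.IsHermitian

open scoped ComplexOrder in
theorem eigenvalues_conjTranspose_mul_self_nonneg (A : Matrix ι ι ℂ) (i : ι) :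
    0 ≤ (Matrix.isHermitian_conjTranspose_mul_self A).eigenvalues i :=
  (Matrix.posSemidef_conjTranspose_mul_self A).eigenvalues_nonneg i

/-- The trace norm is attained as `tr (U A)` with `U` a contraction. -/
theorem exists_norm_le_one_traceNorm_eq (A : Matrix ι ι ℂ) :
    ∃ U : Matrix ι ι ℂ, ‖U‖ ≤ 1 ∧ (U * A).trace = traceNorm A := by
  set hA := Matrix.isHermitian_conjTranspose_mul_self A
  set s : ι → ℝ := fun i => Real.sqrt (hA.eigenvalues i) with hs
  have hs2 : ∀ i, s i ^ 2 = hA.eigenvalues i := fun i =>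
    Real.sq_sqrt (eigenvalues_conjTranspose_mul_self_nonneg A i)
  have hAA : A.conjTranspose * A = hA.spectralMatrix (fun i => (s i : ℂ) ^ 2) := by
    conv_lhs => rw [← hA.spectralMatrix_eigenvalues]
    congr 1
    funext i
    rw [← hs2 i]
    push_cast
    rfl
  -- With $0^{-1}=0$ this is the pseudo-inverse of $|A|$, so $U=|A|^{-1}A^\dagger$ is the adjoint of
  -- the partial isometry in the polar decomposition: $UU^\dagger$ is a projection and $UA=|A|$.
  set r : ι → ℂ := fun i => ((s i)⁻¹ : ℂ) with hr
  refine ⟨hA.spectralMatrix r * A.conjTranspose, ?_, ?_⟩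
  · have h1 : (hA.spectralMatrix r * A.conjTranspose) *
        (hA.spectralMatrix r * A.conjTranspose).conjTranspose =
        hA.spectralMatrix (fun i => if s i = 0 then 0 else 1) := by
      rw [Matrix.conjTranspose_mul, Matrix.conjTranspose_conjTranspose,
        hA.spectralMatrix_conjTranspose, Matrix.mul_assoc, ← Matrix.mul_assoc A.conjTranspose]
      refine (congrArg (fun B => hA.spectralMatrix r * (B * hA.spectralMatrix (star r)))
        hAA).trans ?_
      rw [hA.spectralMatrix_mul, hA.spectralMatrix_mul]
      congr 1
      funext i
      by_cases h : s i = 0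
      · simp [hr, h]
      · have : (s i : ℂ) ≠ 0 := by exact_mod_cast h
        simp [hr, h]
        field_simp
    have h2 : ‖hA.spectralMatrix (fun i => if s i = 0 then (0 : ℂ) else 1)‖ ≤ 1 := by
      have hd : ‖(Matrix.diagonal (fun i => if s i = 0 then (0 : ℂ) else 1))‖ ≤ 1 := by
        rw [Matrix.l2_opNorm_diagonal]
        refine (pi_norm_le_iff_of_nonneg zero_le_one).2 fun i => ?_
        split_ifs <;> simp
      have hv := hA.norm_eigenvectorUnitary_le
      have hv' : ‖(hA.eigenvectorUnitary : Matrix ι ι ℂ).conjTranspose‖ ≤ 1 := by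
        rwa [Matrix.l2_opNorm_conjTranspose]
      refine (norm_mul_le _ _).trans ?_
      refine mul_le_one₀ ((norm_mul_le _ _).trans ?_) (norm_nonneg _) hv'
      exact mul_le_one₀ hv (norm_nonneg _) hd
    rw [← h1, ← Matrix.star_eq_conjTranspose (_ * _), CStarRing.norm_self_mul_star] at h2
    nlinarith [norm_nonneg (hA.spectralMatrix r * A.conjTranspose)]
  · rw [Matrix.mul_assoc]
    refine (congrArg (fun B => (hA.spectralMatrix r * B).trace) hAA).trans ?_
    rw [hA.spectralMatrix_mul, hA.trace_spectralMatrix, traceNorm]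
    push_cast
    refine Finset.sum_congr rfl fun i _ => ?_
    by_cases h : s i = 0
    · have : (Real.sqrt (hA.eigenvalues i)) = 0 := h
      simp [hr, h, this]
    · have h' : (s i : ℂ) ≠ 0 := by exact_mod_cast h
      change (s i : ℂ)⁻¹ * (s i : ℂ) ^ 2 = (s i : ℂ)
      field_simp

/-- To bound a trace norm it suffices to bound `|tr (U A)|` for all contractions `U`. -/
theorem traceNorm_le_of_forall {A : Matrix ι ι ℂ} {r : ℝ}
    (h : ∀ U : Matrix ι ι ℂ, ‖U‖ ≤ 1 → ‖(U * A).trace‖ ≤ r) : traceNorm A ≤ r := by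
  obtain ⟨U, hU, hA⟩ := exists_norm_le_one_traceNorm_eq A
  have := h U hU
  rw [hA, Complex.norm_real] at this
  exact (le_abs_self _).trans this

/-- The Hilbert–Schmidt norm is at most the trace norm. -/
theorem sum_norm_sq_le_traceNorm_sq (A : Matrix ι ι ℂ) :
    ∑ i, ∑ j, ‖A i j‖ ^ 2 ≤ traceNorm A ^ 2 := by
  set hA := Matrix.isHermitian_conjTranspose_mul_self A
  have h1 : ((∑ i, ∑ j, ‖A i j‖ ^ 2 : ℝ) : ℂ) = (A.conjTranspose * A).trace := by
    rw [Finset.sum_comm]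
    simp [Matrix.trace, Matrix.mul_apply, Complex.conj_mul']
  have h2 : (A.conjTranspose * A).trace = ∑ i, (hA.eigenvalues i : ℂ) := hA.trace_eq_sum_eigenvalues
  have h3 : ∑ i, ∑ j, ‖A i j‖ ^ 2 = ∑ i, Real.sqrt (hA.eigenvalues i) ^ 2 := by
    have : ∑ i, Real.sqrt (hA.eigenvalues i) ^ 2 = ∑ i, hA.eigenvalues i :=
      Finset.sum_congr rfl fun i _ => Real.sq_sqrt (eigenvalues_conjTranspose_mul_self_nonneg A i)
    rw [this]
    rw [h2] at h1
    exact_mod_cast h1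
  rw [h3, traceNorm]
  exact Finset.sum_sq_le_sq_sum_of_nonneg fun i _ => Real.sqrt_nonneg _

theorem traceNorm_nonneg (A : Matrix ι ι ℂ) : 0 ≤ traceNorm A :=
  Finset.sum_nonneg fun _ _ => Real.sqrt_nonneg _

end TraceNormDuality

/-! ### Ground space, Gibbs state and the weight of the excited states -/

namespace EdgeInteraction

open scoped Matrix.Norms.L2Operator

variable {V : Type*} [Fintype V] [DecidableEq V] {G : SimpleGraph V} [DecidableRel G.Adj]
  {d : ℕ} (h : EdgeInteraction G d)

theorem exists_energy_eq_groundEnergy (hd : 0 < d) : ∃ i, h.energy i = h.groundEnergy := by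
  have : Nonempty (Fin d) := ⟨⟨0, hd⟩⟩
  exact exists_eq_ciInf_of_finite

/-- The indicator function of the ground state levels. -/
def groundIndicator (i : V → Fin d) : ℂ := if h.energy i = h.groundEnergy then 1 else 0

/-- The ground state degeneracy. -/
def degeneracy : ℕ := (Finset.univ.filter fun i => h.energy i = h.groundEnergy).card

/-- The total Boltzmann weight of the excited states, relative to the ground state energy. -/
def excitedWeight (β : ℝ) : ℝ :=
  ∑ i with h.energy i ≠ h.groundEnergy, Real.exp (-(β * (h.energy i - h.groundEnergy)))

theorem excitedWeight_nonneg (β : ℝ) : 0 ≤ h.excitedWeight β :=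
  Finset.sum_nonneg fun _ _ => (Real.exp_pos _).le

theorem one_le_degeneracy (hd : 0 < d) : 1 ≤ h.degeneracy := by
  obtain ⟨i, hi⟩ := h.exists_energy_eq_groundEnergy hd
  exact Finset.card_pos.2 ⟨i, by simpa using hi⟩

theorem boltzmann_eq_spectralMatrix (β : ℝ) : h.boltzmann β =
    h.isHermitian_hamiltonian.spectralMatrix fun i => (Real.exp (-(β * h.energy i)) : ℂ) := by
  rw [boltzmann, h.isHermitian_hamiltonian.exp_smul_eq_spectralMatrix]
  congr 1
  funext i
  rw [energy]
  push_cast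
  ring_nf

/-- Two identities characterise the spectral matrix $Q$: $HQ=E_0Q$ puts its range into the ground
space, and $R(H-E_0)=1-Q$, with $R$ the pseudo-inverse of $H-E_0$, shows that it fixes the ground
space. As $Q$ is self-adjoint, $x-Qx$ is then orthogonal to that space. -/
theorem groundProjector_eq_spectralMatrix : h.groundProjector =
    h.isHermitian_hamiltonian.spectralMatrix h.groundIndicator := by
  set hH := h.isHermitian_hamiltonian
  set Q := hH.spectralMatrix h.groundIndicator with hQ
  have hHQ : h.hamiltonian * Q = (h.groundEnergy : ℂ) • Q := by
    conv_lhs => rw [← hH.spectralMatrix_eigenvalues]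
    rw [hQ, hH.spectralMatrix_mul, ← hH.spectralMatrix_smul]
    congr 1
    funext i
    change (h.energy i : ℂ) * h.groundIndicator i = (h.groundEnergy : ℂ) * h.groundIndicator i
    unfold groundIndicator
    split_ifs with hi
    · rw [hi]
    · simp
  have hQs : Q.conjTranspose = Q := by
    rw [hQ, hH.spectralMatrix_conjTranspose]
    congr 1
    funext i
    simp only [groundIndicator, Pi.star_apply]
    split_ifs <;> simp
  set R := hH.spectralMatrix fun i => ((h.energy i : ℂ) - h.groundEnergy)⁻¹ with hR
  have hRQ : R * (h.hamiltonian - (h.groundEnergy : ℂ) • 1) = 1 - Q := by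
    have e : h.hamiltonian - (h.groundEnergy : ℂ) • 1 =
        hH.spectralMatrix fun i => (h.energy i : ℂ) - h.groundEnergy := by
      rw [← hH.spectralMatrix_one, ← hH.spectralMatrix_smul]
      conv_lhs => enter [1]; rw [← hH.spectralMatrix_eigenvalues]
      rw [← hH.spectralMatrix_sub]
      congr 1
      funext i
      simp only [Pi.sub_apply, Pi.smul_apply, Pi.one_apply, smul_eq_mul, mul_one]
      rfl
    rw [e, hR, hQ, hH.spectralMatrix_mul, ← hH.spectralMatrix_one, ← hH.spectralMatrix_sub]
    congr 1
    funext i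
    simp only [Pi.mul_apply, Pi.sub_apply, Pi.one_apply, groundIndicator]
    split_ifs with hi
    · simp [hi]
    · rw [sub_zero, inv_mul_cancel₀]
      rw [sub_ne_zero]
      exact_mod_cast hi
  rw [groundProjector, ← (Matrix.toEuclideanCLM (𝕜 := ℂ)).symm_apply_apply Q]
  congr 1
  ext1 x
  refine (?_ : h.groundSpace.starProjection x = Matrix.toEuclideanCLM (𝕜 := ℂ) Q x)
  refine Submodule.eq_starProjection_of_mem_of_inner_eq_zero (K := h.groundSpace) ?_ fun w hw => ?_
  · rw [groundSpace, Module.End.mem_eigenspace_iff]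
    have := congrArg (fun B => Matrix.toEuclideanCLM (𝕜 := ℂ) B x) hHQ
    simp only [map_mul, map_smul] at this
    exact this
  · have hw' : Matrix.toEuclideanCLM (𝕜 := ℂ) h.hamiltonian w = (h.groundEnergy : ℂ) • w :=
      Module.End.mem_eigenspace_iff.1 hw
    have hQw : Matrix.toEuclideanCLM (𝕜 := ℂ) Q w = w := by
      have := congrArg (fun B => Matrix.toEuclideanCLM (𝕜 := ℂ) B w) hRQ
      simp only [map_mul, map_sub, map_smul, map_one] at this
      simp [hw'] at this
      exact (sub_eq_zero.1 this.symm).symm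
    have hadj : inner ℂ (Matrix.toEuclideanCLM (𝕜 := ℂ) Q x) w = inner ℂ x w := by
      conv_rhs => rw [← hQw]
      have : star (Matrix.toEuclideanCLM (𝕜 := ℂ) Q) = Matrix.toEuclideanCLM (𝕜 := ℂ) Q := by
        rw [← map_star, Matrix.star_eq_conjTranspose, hQs]
      conv_lhs => rw [← this, ContinuousLinearMap.star_eq_adjoint]
      rw [ContinuousLinearMap.adjoint_inner_left]
    rw [inner_sub_left, hadj, sub_self]

theorem trace_groundProjector : h.groundProjector.trace = h.degeneracy := by
  rw [groundProjector_eq_spectralMatrix, Matrix.IsHermitian.trace_spectralMatrix, degeneracy]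
  simp [groundIndicator]

theorem rescaled_trace_boltzmann (β : ℝ) :
    Real.exp (β * h.groundEnergy) * (h.boltzmann β).trace.re =
      h.degeneracy + h.excitedWeight β := by
  have h1 : (h.boltzmann β).trace = ((∑ i, Real.exp (-(β * h.energy i)) : ℝ) : ℂ) := by
    rw [boltzmann_eq_spectralMatrix, Matrix.IsHermitian.trace_spectralMatrix]
    push_cast
    rfl
  rw [h1, Complex.ofReal_re, Finset.mul_sum,
    ← Finset.sum_filter_add_sum_filter_not Finset.univ fun i => h.energy i = h.groundEnergy]
  congr 1
  · rw [degeneracy, Finset.card_eq_sum_ones, Nat.cast_sum]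
    refine Finset.sum_congr rfl fun i hi => ?_
    rw [(Finset.mem_filter.1 hi).2, ← Real.exp_add]
    simp
  · refine Finset.sum_congr rfl fun i _ => ?_
    rw [← Real.exp_add]
    ring_nf

theorem norm_trace_mul_rescaled_boltzmann_sub_le (β : ℝ) (U : SpinOp V d) :
    ‖(U * ((Real.exp (β * h.groundEnergy) : ℂ) • h.boltzmann β - h.groundProjector)).trace‖ ≤
      ‖U‖ * h.excitedWeight β := by
  rw [boltzmann_eq_spectralMatrix, groundProjector_eq_spectralMatrix,
    ← Matrix.IsHermitian.spectralMatrix_smul, ← Matrix.IsHermitian.spectralMatrix_sub]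
  refine (Matrix.IsHermitian.norm_trace_mul_spectralMatrix_le _ _ _).trans ?_
  refine mul_le_mul_of_nonneg_left (le_of_eq ?_) (norm_nonneg _)
  rw [excitedWeight, Finset.sum_filter]
  refine Finset.sum_congr rfl fun i _ => ?_
  simp only [Pi.sub_apply, Pi.smul_apply, smul_eq_mul, groundIndicator]
  rw [← Complex.ofReal_mul, ← Real.exp_add]
  by_cases hi : h.energy i = h.groundEnergy
  · simp [hi]
  · rw [if_neg hi, if_pos hi, sub_zero, Complex.norm_real, Real.norm_eq_abs, Real.abs_exp]
    ring_nf

/-- With degeneracy $n$ and excited weight $\eta$, the Gibbs state misses mass $\eta/(n+\eta)$ on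
the ground space and carries the same mass outside it; the sum $2\eta/(n+\eta)$ is at most $2\eta$
because $n\ge1$. -/
theorem traceNorm_gibbs_sub_le (hd : 0 < d) (β : ℝ) :
    traceNorm (h.gibbs β - h.groundProjector.trace⁻¹ • h.groundProjector) ≤
      2 * h.excitedWeight β := by
  set n : ℝ := (h.degeneracy : ℝ) with hn
  set η := h.excitedWeight β with hη
  have hη0 : 0 ≤ η := h.excitedWeight_nonneg β
  have hn1 : 1 ≤ n := Nat.one_le_cast.2 (h.one_le_degeneracy hd)
  set s := Real.exp (β * h.groundEnergy) with hs
  have hs0 : 0 < s := Real.exp_pos _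
  set Z : ℝ := ∑ i, Real.exp (-(β * h.energy i)) with hZ
  have htr : (h.boltzmann β).trace = (Z : ℂ) := by
    rw [boltzmann_eq_spectralMatrix, Matrix.IsHermitian.trace_spectralMatrix, hZ]
    push_cast
    rfl
  have hsZ : s * Z = n + η := by
    have := h.rescaled_trace_boltzmann β
    rwa [htr, Complex.ofReal_re] at this
  have hZ0 : 0 < Z := by
    by_contra hcon
    nlinarith
  have hZinv : Z⁻¹ = s / (n + η) := by
    rw [← hsZ]
    field_simp
  have hU : h.gibbs β - h.groundProjector.trace⁻¹ • h.groundProjector =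
      h.isHermitian_hamiltonian.spectralMatrix
        (((Z⁻¹ : ℝ) : ℂ) • (fun i => (Real.exp (-(β * h.energy i)) : ℂ)) -
          ((n⁻¹ : ℝ) : ℂ) • h.groundIndicator) := by
    rw [gibbs, htr, boltzmann_eq_spectralMatrix, trace_groundProjector,
      groundProjector_eq_spectralMatrix, Matrix.IsHermitian.spectralMatrix_sub,
      Matrix.IsHermitian.spectralMatrix_smul, Matrix.IsHermitian.spectralMatrix_smul]
    push_cast
    rfl
  refine traceNorm_le_of_forall fun U hU1 => ?_
  rw [hU]
  refine (Matrix.IsHermitian.norm_trace_mul_spectralMatrix_le _ _ _).trans ?_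
  refine (mul_le_of_le_one_left (Finset.sum_nonneg fun _ _ => norm_nonneg _) hU1).trans ?_
  have hterm : ∀ i, ‖(((Z⁻¹ : ℝ) : ℂ) • (fun i => (Real.exp (-(β * h.energy i)) : ℂ)) -
          ((n⁻¹ : ℝ) : ℂ) • h.groundIndicator) i‖ =
      if h.energy i = h.groundEnergy then n⁻¹ - (n + η)⁻¹
      else Real.exp (-(β * (h.energy i - h.groundEnergy))) / (n + η) := by
    intro i
    simp only [Pi.sub_apply, Pi.smul_apply, smul_eq_mul, groundIndicator]
    split_ifs with hi
    · rw [mul_one, ← Complex.ofReal_mul, ← Complex.ofReal_sub, Complex.norm_real, hZinv, hi,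
        Real.exp_neg, ← hs, Real.norm_eq_abs, abs_sub_comm, abs_of_nonneg]
      · field_simp
      · have : s / (n + η) * s⁻¹ = (n + η)⁻¹ := by field_simp
        rw [this, sub_nonneg]
        gcongr
        linarith
    · rw [mul_zero, sub_zero, ← Complex.ofReal_mul, Complex.norm_real, hZinv, Real.norm_eq_abs,
        abs_of_nonneg (by positivity), hs, div_mul_eq_mul_div, ← Real.exp_add]
      ring_nf
  simp_rw [hterm]
  rw [Finset.sum_ite, Finset.sum_const, nsmul_eq_mul, ← Finset.sum_div]
  change n * (n⁻¹ - (n + η)⁻¹) + η / (n + η) ≤ 2 * η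
  have e : n * (n⁻¹ - (n + η)⁻¹) + η / (n + η) = 2 * (η / (n + η)) := by
    field_simp
    ring
  rw [e]
  gcongr
  exact div_le_self hη0 (by linarith)

theorem degeneracy_le {c p q : ℝ} (hD : h.PolynomialDensityOfStates c p q) :
    (h.degeneracy : ℝ) ≤ (c * Fintype.card V) ^ q := by
  have := hD 0 le_rfl
  rw [mul_zero, zero_add, add_zero] at this
  refine le_trans ?_ this
  rw [Nat.card_eq_fintype_card, Fintype.card_subtype, degeneracy]
  gcongr with i
  exact fun hi => hi.le

/-- A gap and a polynomial density of states make the excited Boltzmann weight geometrically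
small. -/
theorem excitedWeight_le {Δ c p q β r : ℝ} (hΔ : 0 < Δ) (hp : 0 ≤ p) (hq : 0 ≤ q)
    (hcN : 1 ≤ c * Fintype.card V) (hβ : 0 ≤ β) (hgap : h.HasGap Δ)
    (hD : h.PolynomialDensityOfStates c p q)
    (hr : (c * Fintype.card V) ^ (2 * p * Δ + q) * Real.exp (-(β * Δ)) ≤ r) (hr2 : r ≤ 1 / 2) :
    h.excitedWeight β ≤ 2 * r := by
  set X : ℝ := c * Fintype.card V with hX
  have hX0 : 0 < X := by linarith
  have hr0 : 0 ≤ r := le_trans (by positivity) hr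
  -- Index of the energy shell of width `Δ`; by the gap every excited level has index at least `1`.
  set k : (V → Fin d) → ℕ := fun i => ⌊(h.energy i - h.groundEnergy) / Δ⌋₊ with hk
  set s := Finset.univ.filter fun i => h.energy i ≠ h.groundEnergy with hs
  have hkey : ∀ i ∈ s, 1 ≤ k i ∧ (k i : ℝ) * Δ ≤ h.energy i - h.groundEnergy ∧
      h.energy i - h.groundEnergy ≤ Δ * (k i + 1) := by
    intro i hi
    have hi' : h.energy i ≠ h.groundEnergy := (Finset.mem_filter.1 hi).2
    have hg : Δ ≤ h.energy i - h.groundEnergy := by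
      rcases hgap i with h1 | h1
      · exact absurd h1 hi'
      · linarith
    have hdiv : 1 ≤ (h.energy i - h.groundEnergy) / Δ := by rwa [le_div_iff₀ hΔ, one_mul]
    refine ⟨Nat.le_floor (by exact_mod_cast hdiv), ?_, ?_⟩
    · rw [← le_div_iff₀ hΔ]
      exact Nat.floor_le (by linarith)
    · have := (Nat.lt_floor_add_one ((h.energy i - h.groundEnergy) / Δ)).le
      rwa [div_le_iff₀ hΔ, mul_comm] at this
  have h1 : h.excitedWeight β ≤ ∑ i ∈ s, Real.exp (-(β * Δ)) ^ (k i) := by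
    refine Finset.sum_le_sum fun i hi => ?_
    rw [← Real.exp_nat_mul, Real.exp_le_exp]
    have := (hkey i hi).2.1
    nlinarith
  set B := s.sup k with hB
  have h2 : ∑ i ∈ s, Real.exp (-(β * Δ)) ^ (k i) =
      ∑ m ∈ Finset.Ico 1 (B + 1), ((s.filter fun i => k i = m).card : ℝ) *
        Real.exp (-(β * Δ)) ^ m := by
    rw [← Finset.sum_fiberwise_of_maps_to (t := Finset.Ico 1 (B + 1)) (g := k)]
    · refine Finset.sum_congr rfl fun m _ => ?_
      rw [← nsmul_eq_mul, ← Finset.sum_const]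
      refine Finset.sum_congr rfl fun i hi => ?_
      rw [(Finset.mem_filter.1 hi).2]
    · intro i hi
      rw [Finset.mem_Ico]
      exact ⟨(hkey i hi).1, Nat.lt_succ_of_le (Finset.le_sup hi)⟩
  have h3 : ∀ m ∈ Finset.Ico 1 (B + 1), ((s.filter fun i => k i = m).card : ℝ) *
        Real.exp (-(β * Δ)) ^ m ≤ r ^ m := by
    intro m hm
    have hm1 : (1 : ℝ) ≤ m := by exact_mod_cast (Finset.mem_Ico.1 hm).1
    have hcard : ((s.filter fun i => k i = m).card : ℝ) ≤ X ^ (p * (Δ * (m + 1)) + q) := by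
      refine le_trans ?_ (hD (Δ * (m + 1)) (by positivity))
      rw [Nat.card_eq_fintype_card, Fintype.card_subtype]
      refine Nat.cast_le.2 (Finset.card_le_card fun i hi => ?_)
      obtain ⟨hi, him⟩ := Finset.mem_filter.1 hi
      have := (hkey i hi).2.2
      rw [him] at this
      simp only [Finset.mem_filter, Finset.mem_univ, true_and]
      linarith
    -- Since $m\ge1$, $m+1\le2m$ and $q\le qm$: this is the source of the exponent $2p\Delta+q$ and
    -- turns the shell sum into a geometric one.
    have hexp : X ^ (p * (Δ * (m + 1)) + q) ≤ (X ^ (2 * p * Δ + q)) ^ m := by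
      rw [← Real.rpow_natCast, ← Real.rpow_mul hX0.le]
      refine Real.rpow_le_rpow_of_exponent_le hcN ?_
      have : 0 ≤ p * Δ := by positivity
      nlinarith
    calc _ ≤ (X ^ (2 * p * Δ + q)) ^ m * Real.exp (-(β * Δ)) ^ m := by
          gcongr
          exact hcard.trans hexp
      _ = (X ^ (2 * p * Δ + q) * Real.exp (-(β * Δ))) ^ m := (mul_pow _ _ _).symm
      _ ≤ r ^ m := by gcongr
  refine h1.trans ?_
  rw [h2]
  refine (Finset.sum_le_sum h3).trans ?_
  refine (geom_sum_Ico_le_of_lt_one hr0 (by linarith)).trans ?_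
  rw [pow_one, div_le_iff₀ (by linarith)]
  nlinarith

end EdgeInteraction

/-! ### Combinatorics of tables and inclusion–exclusion -/

section Compression

/-- Distributivity for ordered products in a noncommutative ring. -/
theorem List.prod_ofFn_sum {A β : Type*} [Semiring A] {n : ℕ} (s : Fin n → Finset β)
    (f : Fin n → β → A) :
    (List.ofFn fun i => ∑ b ∈ s i, f i b).prod =
      ∑ p ∈ Fintype.piFinset s, (List.ofFn fun i => f i (p i)).prod := by
  have := (MultilinearMap.mkPiAlgebraFin ℕ n A).map_sum_finset f s
  simpa only [MultilinearMap.mkPiAlgebraFin_apply] using this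

theorem List.norm_prod_ofFn_le {A : Type*} [SeminormedRing A] [NormOneClass A] {n : ℕ}
    (f : Fin n → A) : ‖(List.ofFn f).prod‖ ≤ ∏ i, ‖f i‖ := by
  refine (List.norm_prod_le _).trans_eq ?_
  rw [List.map_ofFn, List.prod_ofFn]
  rfl

variable {ι : Type*} [Fintype ι] [DecidableEq ι]

/-- The factor of the Trotter expansion for a single interaction term. -/
def trotterFactor (s : ℝ) (A : Matrix ι ι ℂ) : Matrix ι ι ℂ := NormedSpace.exp (-(s : ℂ) • A) - 1

variable {n M : ℕ} (A : Fin n → Matrix ι ι ℂ) (s : ℝ)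

/-- The term of the Trotter expansion that belongs to a table of zeros and ones. -/
def tableProduct (t : Fin M → Fin n → Bool) : Matrix ι ι ℂ :=
  (List.ofFn fun j =>
    (List.ofFn fun i => if t j i = true then trotterFactor s (A i) else 1).prod).prod

/-- A row of the Trotter product in which the columns in `S` are expanded according to `τ`. -/
def partialRow (S : Finset (Fin n)) (τ : Fin n → Bool) : Matrix ι ι ℂ :=
  (List.ofFn fun i => if i ∈ S then (if τ i = true then trotterFactor s (A i) else 1)
    else 1 + trotterFactor s (A i)).prod

/-- The sum of all terms of the Trotter expansion whose table agrees with `t` on `S`. -/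
def partialProduct (S : Finset (Fin n)) (t : Fin M → Fin n → Bool) : Matrix ι ι ℂ :=
  (List.ofFn fun j => partialRow A s S (t j)).prod

/-- Erase the columns outside `S` of a table. -/
def maskTable (S : Finset (Fin n)) (t : Fin M → Fin n → Bool) : Fin M → Fin n → Bool :=
  fun j i => if i ∈ S then t j i else false

/-- The tables supported on `S`. -/
def supportedTables (M : ℕ) (S : Finset (Fin n)) : Finset (Fin M → Fin n → Bool) :=
  Fintype.piFinset fun _ => Fintype.piFinset fun i => if i ∈ S then Finset.univ else {false}

/-- The number of ones in a column of a table. -/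
def columnCount (t : Fin M → Fin n → Bool) (i : Fin n) : ℕ :=
  (Finset.univ.filter fun j => t j i = true).card

theorem mem_supportedTables {S : Finset (Fin n)} {t : Fin M → Fin n → Bool} :
    t ∈ supportedTables M S ↔ maskTable S t = t := by
  simp only [supportedTables, Fintype.mem_piFinset, maskTable, funext_iff]
  refine forall_congr' fun j => forall_congr' fun i => ?_
  by_cases hi : i ∈ S
  · simp [hi]
  · simp only [hi, if_false, Finset.mem_singleton]
    exact eq_comm

theorem maskTable_mask (S : Finset (Fin n)) (t : Fin M → Fin n → Bool) :
    maskTable S (maskTable S t) = maskTable S t := by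
  funext j i
  by_cases hi : i ∈ S <;> simp [maskTable, hi]

theorem columnCount_maskTable {S : Finset (Fin n)} (t : Fin M → Fin n → Bool) {i : Fin n}
    (hi : i ∈ S) : columnCount (maskTable S t) i = columnCount t i := by
  simp [columnCount, maskTable, hi]

/-- Expanding the factors $1+x$ outside `S` by distributivity fills those columns in all possible
ways. -/
theorem partialProduct_eq_sum (S : Finset (Fin n)) {t : Fin M → Fin n → Bool}
    (ht : t ∈ supportedTables M S) :
    partialProduct A s S t = ∑ u with maskTable S u = t, tableProduct A s u := by
  have hrow : ∀ j, partialRow A s S (t j) =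
      ∑ p ∈ Fintype.piFinset (fun i => if i ∈ S then {t j i} else Finset.univ),
        (List.ofFn fun i => if p i = true then trotterFactor s (A i) else 1).prod := by
    intro j
    rw [← List.prod_ofFn_sum (fun i => if i ∈ S then {t j i} else Finset.univ)
      (fun i b => if b = true then trotterFactor s (A i) else 1), partialRow]
    congr 2
    funext i
    by_cases hi : i ∈ S
    · simp [hi]
    · simp [hi, add_comm]
  rw [partialProduct]
  simp_rw [hrow]
  rw [List.prod_ofFn_sum (fun j => Fintype.piFinset
    (fun i => if i ∈ S then {t j i} else Finset.univ))
    (fun j p => (List.ofFn fun i => if p i = true then trotterFactor s (A i) else 1).prod)]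
  refine Finset.sum_congr ?_ fun u _ => rfl
  ext u
  rw [mem_supportedTables] at ht
  simp only [Fintype.mem_piFinset, Finset.mem_filter, Finset.mem_univ, true_and]
  constructor
  · intro h
    rw [← ht]
    funext j i
    have := h j i
    by_cases hi : i ∈ S
    · simpa [maskTable, hi] using this
    · simp [maskTable, hi]
  · rintro rfl j i
    by_cases hi : i ∈ S <;> simp [maskTable, hi]

/-- Whether the columns in `S` are overfull depends only on the restriction of a table to `S`, so
the tables satisfying this condition split into the complete fibres of `maskTable S`. -/
theorem sum_partialProduct_eq (L : ℕ) (S : Finset (Fin n)) :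
    ∑ t ∈ (supportedTables M S).filter (fun t => ∀ i ∈ S, L < columnCount t i),
        partialProduct A s S t =
      ∑ u : Fin M → Fin n → Bool,
        (if ∀ i ∈ S, L < columnCount u i then (1 : ℂ) else 0) • tableProduct A s u := by
  have h2 : ∀ t ∈ (supportedTables M S).filter (fun t => ∀ i ∈ S, L < columnCount t i),
      partialProduct A s S t = ∑ u ∈ (Finset.univ.filter
        fun u : Fin M → Fin n → Bool => ∀ i ∈ S, L < columnCount u i).filter
          (fun u => maskTable S u = t), tableProduct A s u := by
    intro t ht
    obtain ⟨ht1, ht2⟩ := Finset.mem_filter.1 ht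
    rw [partialProduct_eq_sum A s S ht1]
    refine Finset.sum_congr ?_ fun _ _ => rfl
    ext u
    simp only [Finset.mem_filter, Finset.mem_univ, true_and]
    constructor
    · intro h
      refine ⟨fun i hi => ?_, h⟩
      rw [← columnCount_maskTable u hi, h]
      exact ht2 i hi
    · exact fun h => h.2
  rw [Finset.sum_congr rfl h2, Finset.sum_fiberwise_of_maps_to]
  · simp_rw [ite_smul, one_smul, zero_smul]
    rw [← Finset.sum_filter]
  · intro u hu
    have hu := (Finset.mem_filter.1 hu).2
    refine Finset.mem_filter.2 ⟨mem_supportedTables.2 (maskTable_mask S u), fun i hi => ?_⟩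
    rw [columnCount_maskTable u hi]
    exact hu i hi

/-- Inclusion–exclusion over the set of columns with too many ones. -/
theorem sum_tableProduct_eq (L : ℕ) :
    ∑ t : Fin M → Fin n → Bool with (∀ i, columnCount t i ≤ L), tableProduct A s t =
      ∑ S : Finset (Fin n), (-1 : ℂ) ^ S.card •
        ∑ t ∈ (supportedTables M S).filter (fun t => ∀ i ∈ S, L < columnCount t i),
          partialProduct A s S t := by
  simp_rw [sum_partialProduct_eq, Finset.smul_sum]
  rw [Finset.sum_comm, Finset.sum_filter]
  refine Finset.sum_congr rfl fun u _ => ?_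
  simp_rw [smul_smul]
  rw [← Finset.sum_smul]
  -- The alternating sum is the expansion of $\prod_i(1-\mathbf 1[\text{column } i\text{
  -- overfull}])$, the indicator of the tables that are kept.
  have h2 : ∑ S : Finset (Fin n), (-1 : ℂ) ^ S.card *
      (if ∀ i ∈ S, L < columnCount u i then (1 : ℂ) else 0) =
      ∏ i, (1 - if L < columnCount u i then (1 : ℂ) else 0) := by
    simp_rw [sub_eq_add_neg]
    rw [Finset.prod_one_add, Finset.powerset_univ]
    refine Finset.sum_congr rfl fun S _ => ?_
    rw [Finset.prod_neg, Finset.prod_ite_zero]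
    simp
  rw [h2]
  by_cases hu : ∀ i, columnCount u i ≤ L
  · rw [if_pos hu, Finset.prod_eq_one, one_smul]
    intro i _
    simp [not_lt.2 (hu i)]
  · rw [if_neg hu]
    push Not at hu
    obtain ⟨i, hi⟩ := hu
    rw [Finset.prod_eq_zero (Finset.mem_univ i), zero_smul]
    simp [hi]

/-- The total weight of the tables with more than `L` ones in each column of `S`. -/
theorem sum_supportedTables_le (S : Finset (Fin n)) (L : ℕ) {y : ℝ} (hy : 0 ≤ y) :
    ∑ t ∈ (supportedTables M S).filter (fun t => ∀ i ∈ S, L < columnCount t i),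
        ∏ j, ∏ i ∈ S, (if t j i = true then y else 1) ≤
      ((1 / 2) ^ L * (1 + 2 * y) ^ M) ^ S.card := by
  -- A Chernoff-type tilt: for a count $m>L$ one has $y^m\le2^{-L}(2y)^m$. After that the constraint
  -- can be dropped and the sum over tables factorises.
  have h1 : ∀ t ∈ (supportedTables M S).filter (fun t => ∀ i ∈ S, L < columnCount t i),
      ∏ j, ∏ i ∈ S, (if t j i = true then y else 1) ≤
        ((1 / 2) ^ L) ^ S.card * ∏ j, ∏ i, (if i ∈ S then
          (if t j i = true then 2 * y else 1) else 1) := by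
    intro t ht
    have ht := (Finset.mem_filter.1 ht).2
    simp_rw [Finset.prod_ite_mem, Finset.univ_inter]
    rw [Finset.prod_comm, Finset.prod_comm (s := Finset.univ), ← Finset.prod_const,
      ← Finset.prod_mul_distrib]
    refine Finset.prod_le_prod (fun i _ => Finset.prod_nonneg fun j _ => by split_ifs <;> simp [hy])
      fun i hi => ?_
    rw [Finset.prod_ite, Finset.prod_ite]
    simp only [Finset.prod_const, mul_one, one_pow]
    change y ^ columnCount t i ≤ (1 / 2) ^ L * (2 * y) ^ columnCount t i
    rw [mul_pow, ← mul_assoc]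
    refine le_mul_of_one_le_left (by positivity) ?_
    rw [one_div, inv_pow, inv_mul_eq_div, one_le_div (by positivity)]
    exact pow_le_pow_right₀ one_le_two (ht i hi).le
  refine (Finset.sum_le_sum h1).trans ?_
  rw [← Finset.mul_sum, mul_pow]
  gcongr
  refine (Finset.sum_le_sum_of_subset_of_nonneg (Finset.filter_subset _ _) fun t _ _ =>
    Finset.prod_nonneg fun j _ => Finset.prod_nonneg fun i _ => by
      split_ifs <;> positivity).trans_eq ?_
  rw [supportedTables, ← Finset.prod_univ_sum (fun _ : Fin M => _)
    (fun (_ : Fin M) (τ : Fin n → Bool) => ∏ i, if i ∈ S then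
          (if τ i = true then 2 * y else 1) else 1)]
  have h2 : ∑ τ ∈ Fintype.piFinset (fun i => if i ∈ S then Finset.univ else {false}),
      ∏ i : Fin n, (if i ∈ S then (if τ i = true then 2 * y else 1) else (1 : ℝ)) =
      (1 + 2 * y) ^ S.card := by
    rw [← Finset.prod_univ_sum (fun i : Fin n => if i ∈ S then Finset.univ else {false})
      (fun i b => if i ∈ S then (if b = true then 2 * y else 1) else (1 : ℝ))]
    rw [← Finset.prod_const, ← Finset.prod_subset (Finset.subset_univ S)]
    · refine Finset.prod_congr rfl fun i hi => ?_
      simp [hi, add_comm]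
    · intro i _ hi
      simp [hi]
  rw [Finset.prod_congr rfl fun _ _ => h2]
  simp [← pow_mul, mul_comm]

end Compression

/-! ### Trotter and compression errors relative to the partition function -/

section CompressionBounds

open scoped Matrix.Norms.L2Operator

variable {ι : Type*} [Fintype ι] [DecidableEq ι] {n M : ℕ}
  {A : Fin n → Matrix ι ι ℂ} {s : ℝ} {H : Matrix ι ι ℂ}

theorem norm_neg_ofReal_smul_le (hs : 0 ≤ s) {B : Matrix ι ι ℂ} (hB : ‖B‖ ≤ 1) :
    ‖-(s : ℂ) • B‖ ≤ s := by
  rw [norm_smul, norm_neg, Complex.norm_real, Real.norm_of_nonneg hs]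
  exact mul_le_of_le_one_right hs hB

theorem one_add_trotterFactor (s : ℝ) (B : Matrix ι ι ℂ) :
    1 + trotterFactor s B = NormedSpace.exp (-(s : ℂ) • B) := by
  simp [trotterFactor]

theorem norm_trotterFactor_le [Nonempty ι] (hs : 0 ≤ s) (hs1 : s ≤ 1) {B : Matrix ι ι ℂ} (hB : ‖B‖ ≤ 1) :
    ‖trotterFactor s B‖ ≤ 2 * s := by
  refine (norm_exp_sub_one_le_exp_norm _).trans ?_
  have h1 := norm_neg_ofReal_smul_le hs hB
  have h2 := Real.abs_exp_sub_one_le (x := s) (by rwa [abs_of_nonneg hs])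
  rw [abs_of_nonneg hs] at h2
  refine le_trans ?_ ((le_abs_self _).trans h2)
  gcongr

theorem norm_hamiltonian_le (hA : ∀ i, ‖A i‖ ≤ 1) (hsum : ∑ i, A i = (2 : ℂ) • H) :
    2 * ‖H‖ ≤ n := by
  have h1 : ‖(2 : ℂ) • H‖ = 2 * ‖H‖ := by rw [norm_smul]; simp
  rw [← h1, ← hsum]
  refine (norm_sum_le _ _).trans ((Finset.sum_le_sum fun i _ => hA i).trans ?_)
  simp

/-- A row in which the columns of `S` carry no small factor: second-order Trotter estimate. -/
theorem norm_exp_mul_prod_sub_one_le [Nonempty ι] (hs : 0 ≤ s) (hsn : 2 * s * n ≤ 1)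
    (hA : ∀ i, ‖A i‖ ≤ 1)
    (hsum : ∑ i, A i = (2 : ℂ) • H) (S : Finset (Fin n)) :
    ‖NormedSpace.exp (((2 * s : ℝ) : ℂ) • H) *
        (List.ofFn fun i => if i ∈ S then 1 else 1 + trotterFactor s (A i)).prod - 1‖ ≤
      s * S.card + (2 * s * n) ^ 2 := by
  -- Columns in `S` become exponentials of `0`. As $\sum_iA_i=2H$, the first-order terms of the row
  -- cancel against those of $e^{2sH}$ except for $s\sum_{i\in S}A_i$, which gives the term $s|S|$;
  -- the rest is second order.
  set B : Fin n → Matrix ι ι ℂ := fun i => if i ∈ S then 0 else -(s : ℂ) • A i with hB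
  set l : List (Matrix ι ι ℂ) := (((2 * s : ℝ) : ℂ) • H) :: List.ofFn B with hl
  have hprod : NormedSpace.exp (((2 * s : ℝ) : ℂ) • H) *
        (List.ofFn fun i => if i ∈ S then 1 else 1 + trotterFactor s (A i)).prod =
      (l.map NormedSpace.exp).prod := by
    rw [hl, List.map_cons, List.prod_cons, List.map_ofFn]
    congr 3
    funext i
    simp only [Function.comp, hB, one_add_trotterFactor]
    split_ifs <;> simp
  have hnorm : (l.map norm).sum ≤ 2 * s * n := by
    rw [hl, List.map_cons, List.sum_cons, List.map_ofFn, List.sum_ofFn]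
    have h1 : ‖((2 * s : ℝ) : ℂ) • H‖ ≤ s * n := by
      rw [norm_smul, Complex.norm_real, Real.norm_of_nonneg (by positivity), mul_comm 2 s, mul_assoc]
      exact mul_le_mul_of_nonneg_left (norm_hamiltonian_le hA hsum) hs
    have h2 : ∑ i, (norm ∘ B) i ≤ ∑ _i : Fin n, s := by
      refine Finset.sum_le_sum fun i _ => ?_
      simp only [Function.comp, hB]
      split_ifs
      · simpa using hs
      · exact norm_neg_ofReal_smul_le hs (hA i)
    rw [Finset.sum_const, Finset.card_univ, Fintype.card_fin, nsmul_eq_mul] at h2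
    linarith
  have hlsum : ‖l.sum‖ ≤ s * S.card := by
    have e : l.sum = ∑ i ∈ S, (s : ℂ) • A i := by
      rw [hl, List.sum_cons, List.sum_ofFn, hB]
      have : ((2 * s : ℝ) : ℂ) • H = ∑ i, (s : ℂ) • A i := by
        rw [← Finset.smul_sum, hsum, smul_smul]
        push_cast
        rw [mul_comm]
      rw [this, ← Finset.sum_add_distrib, ← Finset.sum_subset (Finset.subset_univ S)]
      · refine Finset.sum_congr rfl fun i hi => ?_
        simp [hi]
      · intro i _ hi
        simp [hi]
    rw [e]
    refine (norm_sum_le _ _).trans ((Finset.sum_le_sum fun i _ => ?_).trans_eq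
      (by rw [Finset.sum_const, nsmul_eq_mul, mul_comm]))
    have := norm_neg_ofReal_smul_le hs (hA i)
    rwa [neg_smul, norm_neg] at this
  rw [hprod]
  have h := norm_prod_exp_sub_one_sub_sum_le_sq l hnorm hsn
  calc _ = ‖((l.map NormedSpace.exp).prod - 1 - l.sum) + l.sum‖ := by rw [sub_add_cancel]
    _ ≤ _ := by
      refine (norm_add_le _ _).trans ?_
      linarith

/-- The sharp estimate is needed only for rows without a small factor, where
`norm_exp_mul_prod_sub_one_le` applies. Any other row contains some factor of norm at most $2s$, and
the crude bound $e^{2sn}\le3$ for everything else is absorbed there; this is the origin of $6s$. -/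
theorem norm_exp_mul_partialRow_le [Nonempty ι] (hs : 0 ≤ s) (hsn : 2 * s * n ≤ 1)
    (hA : ∀ i, ‖A i‖ ≤ 1)
    (hsum : ∑ i, A i = (2 : ℂ) • H) (S : Finset (Fin n)) (τ : Fin n → Bool) :
    ‖NormedSpace.exp (((2 * s : ℝ) : ℂ) • H) * partialRow A s S τ‖ ≤
      Real.exp (s * S.card + (2 * s * n) ^ 2) * ∏ i ∈ S, (if τ i = true then 6 * s else 1) := by
  by_cases hτ : ∀ i ∈ S, τ i = false
  · have e1 : partialRow A s S τ =
        (List.ofFn fun i => if i ∈ S then 1 else 1 + trotterFactor s (A i)).prod := by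
      rw [partialRow]
      congr 2
      funext i
      split_ifs with hi hτi
      · simp [hτ i hi] at hτi
      · rfl
      · rfl
    have e2 : ∏ i ∈ S, (if τ i = true then 6 * s else 1) = 1 :=
      Finset.prod_eq_one fun i hi => by simp [hτ i hi]
    rw [e1, e2, mul_one]
    have h1 := norm_exp_mul_prod_sub_one_le hs hsn hA hsum S
    have h2 := Real.add_one_le_exp (s * S.card + (2 * s * n) ^ 2)
    refine le_trans ?_ h2
    rw [← sub_add_cancel (NormedSpace.exp _ * _) 1]
    refine (norm_add_le _ _).trans ?_
    rw [norm_one]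
    linarith
  · push Not at hτ
    obtain ⟨k, hkS, hk⟩ := hτ
    have hn : (1 : ℝ) ≤ n := by exact_mod_cast (Fin.pos k)
    have hs1 : s ≤ 1 := by nlinarith
    have hfac : ∀ i, ‖(if i ∈ S then (if τ i = true then trotterFactor s (A i) else 1)
        else 1 + trotterFactor s (A i))‖ ≤
        Real.exp s * (if i ∈ S then (if τ i = true then 2 * s else 1) else 1) := by
      intro i
      have he : 1 ≤ Real.exp s := Real.one_le_exp hs
      split_ifs
      · refine (norm_trotterFactor_le hs hs1 (hA i)).trans ?_
        exact le_mul_of_one_le_left (by positivity) he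
      · simpa using he
      · rw [one_add_trotterFactor, mul_one]
        refine (norm_exp_le_exp_norm _).trans ?_
        gcongr
        exact norm_neg_ofReal_smul_le hs (hA i)
    have hrow : ‖partialRow A s S τ‖ ≤
        Real.exp (s * n) * ∏ i ∈ S, (if τ i = true then 2 * s else 1) := by
      refine (List.norm_prod_ofFn_le _).trans ?_
      refine (Finset.prod_le_prod (fun i _ => norm_nonneg _) fun i _ => hfac i).trans_eq ?_
      rw [Finset.prod_mul_distrib, Finset.prod_const, Finset.card_univ, Fintype.card_fin,
        ← Real.exp_nat_mul, mul_comm (n : ℝ), Finset.prod_ite_mem, Finset.univ_inter]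
    have hR : ‖NormedSpace.exp (((2 * s : ℝ) : ℂ) • H)‖ ≤ Real.exp (s * n) := by
      refine (norm_exp_le_exp_norm _).trans ?_
      gcongr
      rw [norm_smul, Complex.norm_real, Real.norm_of_nonneg (by positivity), mul_comm 2 s, mul_assoc]
      exact mul_le_mul_of_nonneg_left (norm_hamiltonian_le hA hsum) hs
    have he3 : Real.exp (s * n) * Real.exp (s * n) ≤ 3 := by
      rw [← Real.exp_add]
      refine le_trans ?_ Real.exp_one_lt_three.le
      gcongr
      linarith
    have hprod : 3 * ∏ i ∈ S, (if τ i = true then 2 * s else 1) ≤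
        ∏ i ∈ S, (if τ i = true then 6 * s else 1) := by
      rw [← Finset.mul_prod_erase S _ hkS, ← Finset.mul_prod_erase S _ hkS]
      rw [ne_eq, Bool.not_eq_false] at hk
      simp only [hk, if_true]
      rw [← mul_assoc, ← mul_assoc]
      norm_num
      gcongr with i hi
      split_ifs <;> linarith
    have hnn : 0 ≤ ∏ i ∈ S, (if τ i = true then 2 * s else 1) :=
      Finset.prod_nonneg fun i _ => by split_ifs <;> positivity
    calc _ ≤ Real.exp (s * n) *
          (Real.exp (s * n) * ∏ i ∈ S, (if τ i = true then 2 * s else 1)) :=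
          (norm_mul_le _ _).trans (by gcongr)
      _ ≤ 3 * ∏ i ∈ S, (if τ i = true then 2 * s else 1) := by
          rw [← mul_assoc]
          gcongr
      _ ≤ ∏ i ∈ S, (if τ i = true then 6 * s else 1) := hprod
      _ ≤ _ := by
          refine le_mul_of_one_le_left (Finset.prod_nonneg fun i _ => by
            split_ifs <;> positivity) (Real.one_le_exp (by positivity))

theorem exp_neg_mul_exp_cancel (H : Matrix ι ι ℂ) (r : ℝ) (X : Matrix ι ι ℂ) :
    NormedSpace.exp ((r : ℂ) • -H) * (NormedSpace.exp ((r : ℂ) • H) * X) = X := by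
  rw [← mul_assoc, smul_neg, ← neg_smul, ← Matrix.exp_add_smul]
  simp

/-- Inserting $e^{-2sH}e^{2sH}=1$ before each row brings the product into the form required by
Hölder's inequality, with $-H$ in the exponent. -/
theorem norm_trace_mul_partialProduct_le [Nonempty ι] (hH : H.IsHermitian) (hs : 0 ≤ s)
    (hsn : 2 * s * n ≤ 1) (hA : ∀ i, ‖A i‖ ≤ 1) (hsum : ∑ i, A i = (2 : ℂ) • H)
    (S : Finset (Fin n)) (t : Fin M → Fin n → Bool) (U : Matrix ι ι ℂ) :
    ‖(U * partialProduct A s S t).trace‖ ≤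
      (NormedSpace.exp (((M * (2 * s) : ℝ) : ℂ) • -H)).trace.re * ‖U‖ *
        (Real.exp (s * S.card + (2 * s * n) ^ 2) ^ M *
          ∏ j, ∏ i ∈ S, (if t j i = true then 6 * s else 1)) := by
  have h := Matrix.norm_trace_mul_prod_exp_mul_le hH.neg (w := 2 * s) (by positivity) U
    (List.ofFn fun j => NormedSpace.exp (((2 * s : ℝ) : ℂ) • H) * partialRow A s S (t j))
  rw [List.map_ofFn, List.map_ofFn, List.length_ofFn] at h
  have e : (List.ofFn ((fun B => NormedSpace.exp (((2 * s : ℝ) : ℂ) • -H) * B) ∘ fun j =>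
      NormedSpace.exp (((2 * s : ℝ) : ℂ) • H) * partialRow A s S (t j))).prod =
      partialProduct A s S t := by
    rw [partialProduct]
    congr 2
    funext j
    exact exp_neg_mul_exp_cancel H (2 * s) _
  rw [e, List.prod_ofFn] at h
  refine h.trans ?_
  have hZ := Matrix.trace_exp_re_nonneg hH.neg (M * (2 * s))
  gcongr
  rw [← Fin.prod_const, ← Finset.prod_mul_distrib]
  exact Finset.prod_le_prod (fun j _ => norm_nonneg _) fun j _ =>
    norm_exp_mul_partialRow_le hs hsn hA hsum S (t j)

theorem pow_sub_pow_eq_sum {R : Type*} [Ring R] (a b : R) (m : ℕ) :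
    a ^ m - b ^ m = ∑ j ∈ Finset.range m, a ^ j * (a - b) * b ^ (m - 1 - j) := by
  induction m with
  | zero => simp
  | succ m ih =>
    rw [Finset.sum_range_succ]
    have h1 : ∑ j ∈ Finset.range m, a ^ j * (a - b) * b ^ (m + 1 - 1 - j) =
        (∑ j ∈ Finset.range m, a ^ j * (a - b) * b ^ (m - 1 - j)) * b := by
      rw [Finset.sum_mul]
      refine Finset.sum_congr rfl fun j hj => ?_
      have hj := Finset.mem_range.1 hj
      rw [mul_assoc _ _ b, ← pow_succ]
      congr 2
      omega
    rw [h1, ← ih]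
    simp only [Nat.add_sub_cancel, Nat.sub_self, pow_zero, mul_one]
    rw [pow_succ, pow_succ]
    noncomm_ring

/-- The Trotter error in trace norm, relative to the partition function. -/
theorem norm_trace_mul_trotter_sub_le [Nonempty ι] (hH : H.IsHermitian) (hs : 0 ≤ s)
    (hsn : 2 * s * n ≤ 1) (hA : ∀ i, ‖A i‖ ≤ 1) (hsum : ∑ i, A i = (2 : ℂ) • H)
    (U : Matrix ι ι ℂ) :
    ‖(U * ((List.ofFn fun i => 1 + trotterFactor s (A i)).prod ^ M -
        NormedSpace.exp (((M * (2 * s) : ℝ) : ℂ) • -H))).trace‖ ≤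
      (NormedSpace.exp (((M * (2 * s) : ℝ) : ℂ) • -H)).trace.re * ‖U‖ *
        (M * (2 * s * n) ^ 2 * Real.exp (M * (2 * s * n) ^ 2)) := by
  set R := NormedSpace.exp (((2 * s : ℝ) : ℂ) • -H) with hR
  set Y := (List.ofFn fun i => 1 + trotterFactor s (A i)).prod with hY
  set B := NormedSpace.exp (((2 * s : ℝ) : ℂ) • H) * Y with hB
  set a := 2 * s * n with ha
  set Z := (NormedSpace.exp (((M * (2 * s) : ℝ) : ℂ) • -H)).trace.re with hZdef
  have hZ : 0 ≤ Z := Matrix.trace_exp_re_nonneg hH.neg (M * (2 * s))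
  have hYB : Y = R * B := (exp_neg_mul_exp_cancel H (2 * s) Y).symm
  have hB1 : ‖B - 1‖ ≤ a ^ 2 := by
    have := norm_exp_mul_prod_sub_one_le hs hsn hA hsum ∅
    simpa [hB, hY, ha] using this
  have hBn : ‖B‖ ≤ Real.exp (a ^ 2) := by
    refine le_trans ?_ (Real.add_one_le_exp _)
    rw [← sub_add_cancel B 1]
    refine (norm_add_le _ _).trans ?_
    rw [norm_one]
    linarith
  have hRM : NormedSpace.exp (((M * (2 * s) : ℝ) : ℂ) • -H) = R ^ M := by
    rw [hR, ← Matrix.exp_nsmul, ← Nat.cast_smul_eq_nsmul ℂ, smul_smul]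
    push_cast
    rfl
  rw [hRM, pow_sub_pow_eq_sum, Finset.mul_sum, Matrix.trace_sum]
  have hterm : ∀ j ∈ Finset.range M,
      ‖(U * (Y ^ j * (Y - R) * R ^ (M - 1 - j))).trace‖ ≤
        Z * ‖U‖ * (Real.exp (M * a ^ 2) * a ^ 2) := by
    intro j hj
    have hj := Finset.mem_range.1 hj
    -- With $Y=RB$, the telescoping term $Y^j(Y-R)R^{M-1-j}$ is a product of `M` rows $RB_i$, where
    -- $B_i$ is $B$ in the first $j$ rows, then $B-1$ once, then $1$.
    have h := Matrix.norm_trace_mul_prod_exp_mul_le hH.neg (w := 2 * s) (by positivity) U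
      (List.replicate j B ++ (B - 1) :: List.replicate (M - 1 - j) 1)
    have hlen : (List.replicate j B ++ (B - 1) :: List.replicate (M - 1 - j) 1).length = M := by
      simp
      omega
    rw [hlen, ← hZdef] at h
    simp only [List.map_append, List.map_replicate, List.map_cons, List.prod_append,
      List.prod_replicate, List.prod_cons, ← hR, mul_sub, mul_one, norm_one, one_pow,
      ← hYB] at h
    rw [mul_assoc (Y ^ j)]
    refine h.trans ?_
    gcongr
    calc ‖B‖ ^ j ≤ Real.exp (a ^ 2) ^ j := by gcongr
      _ = Real.exp (j * a ^ 2) := by rw [← Real.exp_nat_mul]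
      _ ≤ _ := by gcongr
  refine (norm_sum_le _ _).trans ((Finset.sum_le_sum hterm).trans_eq ?_)
  rw [Finset.sum_const, Finset.card_range, nsmul_eq_mul]
  ring

/-- The error of the compressed Trotter expansion in trace norm, relative to the partition
function. -/
theorem norm_trace_mul_compressed_sub_le [Nonempty ι] (hH : H.IsHermitian) (hs : 0 ≤ s)
    (hsn : 2 * s * n ≤ 1) (hA : ∀ i, ‖A i‖ ≤ 1) (hsum : ∑ i, A i = (2 : ℂ) • H)
    (U : Matrix ι ι ℂ) (L : ℕ) :
    ‖(U * (∑ t : Fin M → Fin n → Bool with (∀ i, columnCount t i ≤ L), tableProduct A s t -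
        NormedSpace.exp (((M * (2 * s) : ℝ) : ℂ) • -H))).trace‖ ≤
      (NormedSpace.exp (((M * (2 * s) : ℝ) : ℂ) • -H)).trace.re * ‖U‖ *
        (Real.exp (M * (2 * s * n) ^ 2) *
          ((1 + (1 / 2) ^ L * Real.exp (13 * (s * M))) ^ n - 1 + M * (2 * s * n) ^ 2)) := by
  set a := 2 * s * n with ha
  set Z := (NormedSpace.exp (((M * (2 * s) : ℝ) : ℂ) • -H)).trace.re with hZdef
  have hZ : 0 ≤ Z := Matrix.trace_exp_re_nonneg hH.neg (M * (2 * s))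
  -- Cost of one overfull column. Of the exponent, `12` comes from $(1+2y)^M$ with $y=6s$, and `1`
  -- from the uncancelled first-order term $s$ in each of the `M` rows.
  set θ := (1 / 2 : ℝ) ^ L * Real.exp (13 * (s * M)) with hθ
  set F : Finset (Fin n) → Matrix ι ι ℂ := fun S =>
    ∑ t ∈ (supportedTables M S).filter (fun t => ∀ i ∈ S, L < columnCount t i),
      partialProduct A s S t with hF
  have hF0 : F ∅ = (List.ofFn fun i => 1 + trotterFactor s (A i)).prod ^ M := by
    have h1 : (supportedTables M (∅ : Finset (Fin n))).filter
        (fun t => ∀ i ∈ (∅ : Finset (Fin n)), L < columnCount t i) = {fun _ _ => false} := by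
      ext t
      simp only [Finset.mem_filter, mem_supportedTables, Finset.mem_singleton]
      constructor
      · rintro ⟨h, -⟩
        rw [← h]
        funext j i
        simp [maskTable]
      · rintro rfl
        refine ⟨?_, by simp⟩
        funext j i
        simp [maskTable]
    rw [hF]
    simp only [h1, Finset.sum_singleton, partialProduct, partialRow]
    simp
  have hFS : ∀ S, ‖(U * F S).trace‖ ≤ Z * ‖U‖ * (Real.exp (M * a ^ 2) * θ ^ S.card) := by
    intro S
    rw [hF, Finset.mul_sum, Matrix.trace_sum]
    refine (norm_sum_le _ _).trans ((Finset.sum_le_sum fun t _ =>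
      norm_trace_mul_partialProduct_le hH hs hsn hA hsum S t U).trans ?_)
    rw [← Finset.mul_sum, ← Finset.mul_sum]
    refine mul_le_mul_of_nonneg_left ?_ (by positivity)
    refine (mul_le_mul_of_nonneg_left (sum_supportedTables_le S L (y := 6 * s) (by positivity))
      (by positivity)).trans ?_
    rw [← Real.exp_nat_mul, mul_add, Real.exp_add, mul_comm (Real.exp (M * (s * S.card))), mul_assoc]
    gcongr
    have h1 : (1 + 2 * (6 * s)) ^ M ≤ Real.exp (12 * (s * M)) := by
      have : 1 + 2 * (6 * s) ≤ Real.exp (12 * s) := by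
        have := Real.add_one_le_exp (12 * s)
        linarith
      calc _ ≤ Real.exp (12 * s) ^ M := by gcongr
        _ = _ := by rw [← Real.exp_nat_mul]; ring_nf
    have h2 : Real.exp (M * (s * S.card)) = Real.exp (s * M) ^ S.card := by
      rw [← Real.exp_nat_mul]
      ring_nf
    rw [h2, ← mul_pow]
    gcongr
    calc _ ≤ Real.exp (s * M) * ((1 / 2) ^ L * Real.exp (12 * (s * M))) := by gcongr
      _ = (1 / 2) ^ L * (Real.exp (s * M) * Real.exp (12 * (s * M))) := by ring
      _ = θ := by rw [← Real.exp_add, hθ]; ring_nf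
  have hsplit : ∑ t : Fin M → Fin n → Bool with (∀ i, columnCount t i ≤ L), tableProduct A s t =
      F ∅ + ∑ S ∈ Finset.univ.erase ∅, (-1 : ℂ) ^ S.card • F S := by
    rw [sum_tableProduct_eq, ← Finset.add_sum_erase _ _ (Finset.mem_univ ∅)]
    simp [hF]
  rw [hsplit, add_sub_right_comm, mul_add, Matrix.trace_add, hF0]
  refine (norm_add_le _ _).trans ?_
  have hrest : ‖(U * ∑ S ∈ Finset.univ.erase ∅, (-1 : ℂ) ^ S.card • F S).trace‖ ≤
      Z * ‖U‖ * (Real.exp (M * a ^ 2) * ((1 + θ) ^ n - 1)) := by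
    rw [Finset.mul_sum, Matrix.trace_sum]
    refine (norm_sum_le _ _).trans ((Finset.sum_le_sum
      (g := fun S => Z * ‖U‖ * (Real.exp (M * a ^ 2) * θ ^ S.card)) fun S _ => ?_).trans_eq ?_)
    · rw [Matrix.mul_smul, Matrix.trace_smul, norm_smul]
      simpa using hFS S
    · rw [← Finset.mul_sum, ← Finset.mul_sum]
      congr 2
      -- The binomial formula $\sum_S\theta^{|S|}=(1+\theta)^n$, with the empty set removed.
      have h1 := Fintype.sum_pow_mul_eq_add_pow (Fin n) θ 1
      rw [← Finset.add_sum_erase _ _ (Finset.mem_univ ∅)] at h1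
      simp only [one_pow, mul_one, Finset.card_empty, pow_zero, Fintype.card_fin] at h1
      rw [add_comm 1 θ, ← h1]
      ring
  refine (add_le_add (norm_trace_mul_trotter_sub_le hH hs hsn hA hsum U) hrest).trans_eq ?_
  ring

end CompressionBounds

/-! ### The rescaled compressed Trotter operator against the ground state projector -/

namespace EdgeInteraction

open scoped Matrix.Norms.L2Operator

variable {V : Type*} [Fintype V] [DecidableEq V] {G : SimpleGraph V} [DecidableRel G.Adj]
  {d : ℕ} (h : EdgeInteraction G d) {K : ℕ} (ord : Fin K ≃ G.edgeSet)

theorem compressedTrotter_eq (β : ℝ) (M L : ℕ) : h.compressedTrotter ord β M L =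
    ∑ t : Fin M → Fin (K + K) → Bool with (∀ i, columnCount t i ≤ L),
      tableProduct (fun i => h.term (column ord i)) (β / (2 * M)) t :=
  rfl

theorem sum_term_column : ∑ i, h.term (column ord i) = (2 : ℂ) • h.hamiltonian := by
  have h1 : ∑ i : Fin K, h.term (ord i) = h.hamiltonian := Equiv.sum_comp ord h.term
  have h2 : ∑ i : Fin K, h.term (ord i.rev) = h.hamiltonian :=
    (Equiv.sum_comp (Fin.revPerm.trans ord) h.term :)
  rw [Fin.sum_univ_add]
  simp only [column, Fin.append_left, Fin.append_right]
  rw [h1, h2, two_smul]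

/-- The trace norm distance of the rescaled compressed Trotter operator to the ground state
projector, as a bound for all contractions `U`. -/
theorem norm_trace_mul_rescaled_compressedTrotter_sub_le (hd : 0 < d) {β : ℝ} (hβ : 0 ≤ β)
    {M : ℕ} (hM : 0 < M) (hMβ : 2 * β * K ≤ M) (L : ℕ) {U : SpinOp V d} (hU : ‖U‖ ≤ 1) :
    ‖(U * ((Real.exp (β * h.groundEnergy) : ℂ) • h.compressedTrotter ord β M L
        - h.groundProjector)).trace‖ ≤
      (h.degeneracy + h.excitedWeight β) * (Real.exp (4 * β ^ 2 * K ^ 2 / M) *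
          ((1 + (1 / 2) ^ L * Real.exp (7 * β)) ^ (K + K) - 1 + 4 * β ^ 2 * K ^ 2 / M)) +
        h.excitedWeight β := by
  have : Nonempty (Fin d) := ⟨⟨0, hd⟩⟩
  have hM0 : (0 : ℝ) < M := by exact_mod_cast hM
  set E : ℂ := (Real.exp (β * h.groundEnergy) : ℂ) with hE
  have key := norm_trace_mul_compressed_sub_le (M := M) (s := β / (2 * M))
    h.isHermitian_hamiltonian (by positivity)
    (by push_cast; field_simp; linarith) (fun i => h.norm_le_one (column ord i))
    (h.sum_term_column ord) U L
  rw [← compressedTrotter_eq] at key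
  have e1 : NormedSpace.exp (((M * (2 * (β / (2 * M))) : ℝ) : ℂ) • -h.hamiltonian) =
      h.boltzmann β := by
    rw [boltzmann, smul_neg, neg_smul]
    congr 3
    field_simp
  have e2 : (M : ℝ) * (2 * (β / (2 * M)) * ((K + K : ℕ) : ℝ)) ^ 2 = 4 * β ^ 2 * K ^ 2 / M := by
    push_cast
    field_simp
    ring
  -- With $s=\beta/2M$ the exponent is $13\beta/2$, rounded up to $7\beta$.
  have e3 : 13 * (β / (2 * M) * M) ≤ 7 * β := by
    have : β / (2 * M) * M = β / 2 := by field_simp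
    rw [this]
    linarith
  rw [e1, e2] at key
  have hZ : 0 ≤ (h.boltzmann β).trace.re := by
    rw [← e1]
    exact Matrix.trace_exp_re_nonneg h.isHermitian_hamiltonian.neg _
  have hEn : ‖E‖ = Real.exp (β * h.groundEnergy) := by
    rw [hE, Complex.norm_real, Real.norm_eq_abs, Real.abs_exp]
  have hsplit : E • h.compressedTrotter ord β M L - h.groundProjector =
      E • (h.compressedTrotter ord β M L - h.boltzmann β) +
        (E • h.boltzmann β - h.groundProjector) := by
    rw [smul_sub]
    abel
  rw [hsplit, mul_add, Matrix.trace_add]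
  refine (norm_add_le _ _).trans (add_le_add ?_ ?_)
  · rw [Matrix.mul_smul, Matrix.trace_smul, norm_smul, hEn]
    calc _ ≤ Real.exp (β * h.groundEnergy) * ((h.boltzmann β).trace.re * 1 *
          (Real.exp (4 * β ^ 2 * K ^ 2 / M) *
          ((1 + (1 / 2) ^ L * Real.exp (7 * β)) ^ (K + K) - 1 + 4 * β ^ 2 * K ^ 2 / M))) := by
          refine mul_le_mul_of_nonneg_left (key.trans ?_) (Real.exp_pos _).le
          have : (1 : ℝ) ≤ (1 + (1 / 2) ^ L * Real.exp (13 * (β / (2 * M) * M))) ^ (K + K) :=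
            one_le_pow₀ (le_add_of_nonneg_right (by positivity))
          have : (0 : ℝ) ≤ 4 * β ^ 2 * K ^ 2 / M := by positivity
          have h0 : (0 : ℝ) ≤ (1 + (1 / 2) ^ L * Real.exp (13 * (β / (2 * M) * M))) ^ (K + K) - 1 +
              4 * β ^ 2 * K ^ 2 / M := by linarith
          gcongr
      _ = _ := by
          rw [← h.rescaled_trace_boltzmann β]
          ring
  · exact (h.norm_trace_mul_rescaled_boltzmann_sub_le β U).trans
      (mul_le_of_le_one_left (h.excitedWeight_nonneg β) hU)

end EdgeInteraction

/-! ### Local operators and product operators -/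

section ProductOperators

open scoped Matrix.Norms.L2Operator Kronecker

variable {V : Type*} [Fintype V] [DecidableEq V] {d : ℕ}

/-- The embedding `B ↦ B ⊗ 1` of the operators on the spins in `s`. -/
def localEmbedding (s : Set V) [DecidablePred (· ∈ s)] :
    Matrix (s → Fin d) (s → Fin d) ℂ →+* SpinOp V d where
  toFun B := (B ⊗ₖ (1 : Matrix ({v // v ∉ s} → Fin d) ({v // v ∉ s} → Fin d) ℂ)).submatrix
    (Equiv.piEquivPiSubtypeProd (· ∈ s) fun _ => Fin d)
    (Equiv.piEquivPiSubtypeProd (· ∈ s) fun _ => Fin d)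
  map_one' := by rw [Matrix.one_kronecker_one]; exact Matrix.submatrix_one_equiv _
  map_mul' B C := by
    rw [Matrix.submatrix_mul_equiv, ← Matrix.mul_kronecker_mul, mul_one]
  map_zero' := by rw [Matrix.zero_kronecker]; rfl
  map_add' B C := by rw [Matrix.add_kronecker]; rfl

theorem localEmbedding_apply (s : Set V) [DecidablePred (· ∈ s)]
    (B : Matrix (s → Fin d) (s → Fin d) ℂ) (σ τ : V → Fin d) :
    localEmbedding s B σ τ =
      if ∀ v, v ∉ s → σ v = τ v then B (fun v => σ v) (fun v => τ v) else 0 := by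
  change B (fun v => σ v) (fun v => τ v) *
    (1 : Matrix ({v // v ∉ s} → Fin d) ({v // v ∉ s} → Fin d) ℂ) (fun v => σ v) (fun v => τ v) = _
  rw [Matrix.one_apply]
  simp only [funext_iff, Subtype.forall, mul_ite, mul_one, mul_zero]

theorem SpinOp.actsOn_iff {s : Set V} [DecidablePred (· ∈ s)] {A : SpinOp V d} :
    A.ActsOn s ↔ ∃ B, localEmbedding s B = A := by
  refine exists_congr fun B => ?_
  constructor
  · intro h
    ext σ τ
    rw [localEmbedding_apply]
    split_ifs with hστ
    · exact ((h σ τ).1 hστ).symm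
    · push Not at hστ
      exact ((h σ τ).2 hστ).symm
  · rintro rfl σ τ
    rw [localEmbedding_apply]
    refine ⟨fun h => if_pos h, fun ⟨v, hv, hne⟩ => if_neg fun h => hne (h v hv)⟩

theorem localEmbedding_continuous (s : Set V) [DecidablePred (· ∈ s)] :
    Continuous (localEmbedding (d := d) s) := by
  refine continuous_pi fun σ => continuous_pi fun τ => ?_
  simp_rw [localEmbedding_apply]
  split_ifs
  · exact (continuous_apply _).comp (continuous_apply _)
  · exact continuous_const

theorem localEmbedding_smul (s : Set V) [DecidablePred (· ∈ s)] (c : ℂ)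
    (B : Matrix (s → Fin d) (s → Fin d) ℂ) :
    localEmbedding s (c • B) = c • localEmbedding s B := by
  ext σ τ
  simp only [localEmbedding_apply, Matrix.smul_apply]
  split_ifs <;> simp

/-- The map $B\mapsto B\otimes1$ is a continuous ring homomorphism, hence commutes with the
exponential. -/
theorem trotterFactor_actsOn {s : Set V} {A : SpinOp V d} (hA : A.ActsOn s) (r : ℝ) :
    SpinOp.ActsOn s (NormedSpace.exp (-(r : ℂ) • A) - 1) := by
  classical
  obtain ⟨B, rfl⟩ := SpinOp.actsOn_iff.1 hA
  refine SpinOp.actsOn_iff.2 ⟨NormedSpace.exp (-(r : ℂ) • B) - 1, ?_⟩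
  let _ : NormedAlgebra ℚ (Matrix (s → Fin d) (s → Fin d) ℂ) := .restrictScalars ℚ ℂ _
  let _ : NormedAlgebra ℚ (SpinOp V d) := .restrictScalars ℚ ℂ _
  rw [map_sub, map_one, NormedSpace.map_exp _ (localEmbedding_continuous s), localEmbedding_smul]

/-- The product operator `⨂_v Y_v`. -/
def productOp : (V → Matrix (Fin d) (Fin d) ℂ) →* SpinOp V d where
  toFun Y := Matrix.of fun σ τ => ∏ v, Y v (σ v) (τ v)
  map_one' := by
    ext σ τ
    simp only [Matrix.of_apply, Pi.one_apply, Matrix.one_apply, Finset.prod_ite_zero,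
      Finset.prod_const_one, Finset.mem_univ, true_imp_iff, funext_iff]
  map_mul' Y Z := by
    ext σ τ
    simp only [Matrix.of_apply, Pi.mul_apply, Matrix.mul_apply]
    rw [Finset.prod_univ_sum, Fintype.piFinset_univ]
    exact Finset.sum_congr rfl fun ρ _ => Finset.prod_mul_distrib

theorem productOp_apply (Y : V → Matrix (Fin d) (Fin d) ℂ) (σ τ : V → Fin d) :
    productOp Y σ τ = ∏ v, Y v (σ v) (τ v) := rfl

/-- A two-body operator is a sum of `d²` product operators. -/
theorem exists_sum_productOp_of_actsOn {u v : V} (huv : u ≠ v) {A : SpinOp V d}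
    (hA : A.ActsOn {w | w ∈ s(u, v)}) :
    ∃ Y : Fin d × Fin d → V → Matrix (Fin d) (Fin d) ℂ,
      (∀ a w, w ∉ s(u, v) → Y a w = 1) ∧ A = ∑ a, productOp (Y a) := by
  obtain ⟨B, hB⟩ := hA
  -- Expansion in matrix units at `u`: the label `a` selects the unit at `u`, and the matching block
  -- of `B` is placed at `v`.
  set Y : Fin d × Fin d → V → Matrix (Fin d) (Fin d) ℂ := fun a w =>
    if w = u then Matrix.single a.1 a.2 1
    else if w = v then Matrix.of fun m m' =>
      B (fun w => if (w : V) = u then a.1 else m) (fun w => if (w : V) = u then a.2 else m')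
    else 1 with hY
  refine ⟨Y, ?_, ?_⟩
  · intro a w hw
    rw [Sym2.mem_iff, not_or] at hw
    simp [hY, hw.1, hw.2]
  ext σ τ
  rw [Matrix.sum_apply]
  have hterm : ∀ a : Fin d × Fin d, productOp (Y a) σ τ =
      if a = (σ u, τ u) then
        (if ∀ w, w ∉ s(u, v) → σ w = τ w then B (fun w => σ w) (fun w => τ w) else 0) else 0 := by
    intro a
    rw [productOp_apply, ← Finset.mul_prod_erase _ _ (Finset.mem_univ u),
      ← Finset.mul_prod_erase _ _ (Finset.mem_erase.2 ⟨huv.symm, Finset.mem_univ v⟩)]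
    have hrest : ∏ w ∈ (Finset.univ.erase u).erase v, Y a w (σ w) (τ w) =
        if ∀ w, w ∉ s(u, v) → σ w = τ w then 1 else 0 := by
      have : ∀ w ∈ (Finset.univ.erase u).erase v, Y a w (σ w) (τ w) =
          if σ w = τ w then 1 else 0 := by
        intro w hw
        simp only [Finset.mem_erase, Finset.mem_univ, and_true] at hw
        simp [hY, hw.1, hw.2, Matrix.one_apply]
      rw [Finset.prod_congr rfl this, Finset.prod_ite_zero, Finset.prod_const_one]
      have : (∀ w ∈ (Finset.univ.erase u).erase v, σ w = τ w) ↔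
          ∀ w, w ∉ s(u, v) → σ w = τ w := by
        simp [Sym2.mem_iff, not_or, and_comm]
      simp only [this]
    rw [hrest]
    have hu : Y a u (σ u) (τ u) = if a = (σ u, τ u) then 1 else 0 := by
      simp only [hY, if_true, Matrix.single_apply, Prod.ext_iff]
    rw [hu]
    by_cases ha : a = (σ u, τ u)
    · subst ha
      have hv : Y (σ u, τ u) v (σ v) (τ v) = B (fun w => σ w) (fun w => τ w) := by
        simp only [hY, huv.symm, if_false, if_true, Matrix.of_apply]
        congr 1 <;>
        · funext w
          obtain ⟨w, hw⟩ := w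
          rcases Sym2.mem_iff.1 hw with rfl | rfl
          · simp
          · simp [huv.symm]
      rw [hv]
      simp
    · simp [ha]
  simp_rw [hterm]
  rw [Finset.sum_ite_eq' Finset.univ, if_pos (Finset.mem_univ _)]
  split_ifs with hστ
  · exact (hB σ τ).1 hστ
  · push Not at hστ
    exact (hB σ τ).2 hστ

end ProductOperators

/-! ### Closure properties of PEPOs and PEPSs -/

section TensorNetworks

variable {V : Type*} [Fintype V] [DecidableEq V] {G : SimpleGraph V} [DecidableRel G.Adj] {d : ℕ}

/-- Bond indices may be taken from any finite type. -/
theorem IsPEPO.of_fintype {I : Type*} [Fintype I] [DecidableEq I] {A : SpinOp V d}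
    (X : (v : V) → ({e : G.edgeSet // v ∈ (e : Sym2 V)} → I) → Matrix (Fin d) (Fin d) ℂ)
    (hA : A = ∑ α : G.edgeSet → I, productOp fun v => X v fun e => α e.1) :
    IsPEPO G (Fintype.card I) A := by
  refine ⟨fun v a => X v fun e => (Fintype.equivFin I).symm (a e), fun σ τ => ?_⟩
  rw [hA, Matrix.sum_apply]
  exact (Equiv.sum_comp (Equiv.arrowCongr (Equiv.refl _) (Fintype.equivFin I).symm)
    fun α : G.edgeSet → I => productOp (fun v => X v fun e => α e.1) σ τ).symm

theorem IsPEPO.smul [Nonempty V] {D : ℕ} {A : SpinOp V d} (hA : IsPEPO G D A) (c : ℂ) :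
    IsPEPO G D (c • A) := by
  obtain ⟨X, hX⟩ := hA
  obtain ⟨v₀⟩ := ‹Nonempty V›
  refine ⟨fun v a => (if v = v₀ then c else 1) • X v a, fun σ τ => ?_⟩
  rw [Matrix.smul_apply, hX, smul_eq_mul, Finset.mul_sum]
  refine Finset.sum_congr rfl fun α _ => ?_
  simp only [Matrix.smul_apply, smul_eq_mul, Finset.prod_mul_distrib]
  simp

theorem IsPEPS.smul [Nonempty V] {D : ℕ} {ψ : SpinVec V d} (hψ : IsPEPS G D ψ) (c : ℂ) :
    IsPEPS G D (c • ψ) := by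
  obtain ⟨X, hX⟩ := hψ
  obtain ⟨v₀⟩ := ‹Nonempty V›
  refine ⟨fun v a i => (if v = v₀ then c else 1) * X v a i, fun σ => ?_⟩
  rw [PiLp.smul_apply, hX, smul_eq_mul, Finset.mul_sum]
  refine Finset.sum_congr rfl fun α _ => ?_
  rw [Finset.prod_mul_distrib]
  simp

/-- A PEPO maps product basis vectors to PEPSs. -/
theorem IsPEPO.isPEPS_col {D : ℕ} {A : SpinOp V d} (hA : IsPEPO G D A) (τ : V → Fin d) :
    IsPEPS G D (WithLp.toLp 2 fun σ => A σ τ) := by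
  obtain ⟨X, hX⟩ := hA
  exact ⟨fun v a i => X v a i (τ v), fun σ => hX σ τ⟩

end TensorNetworks

/-! ### Counting sparse labelled columns -/

section SparseColumns

/-- Columns of length `M` with labels from `O` in at most `L` places. -/
def SparseColumn (M L : ℕ) (O : Type*) : Type _ :=
  {g : Fin M → Option O // (Finset.univ.filter fun j => (g j).isSome = true).card ≤ L}

variable {M L : ℕ} {O : Type*} [Fintype O] [DecidableEq O]

instance : Fintype (SparseColumn M L O) := Subtype.fintype _

instance : DecidableEq (SparseColumn M L O) := inferInstanceAs (DecidableEq {g : Fin M → Option O //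
  (Finset.univ.filter fun j => (g j).isSome = true).card ≤ L})

/-- A sparse column can be recovered from `L` slots, each of them empty or holding a row together
with its label. -/
theorem card_sparseColumn_le :
    Fintype.card (SparseColumn M L O) ≤ (1 + M * Fintype.card O) ^ L := by
  classical
  have hcard : Fintype.card (Fin L → Option (Fin M × O)) = (1 + M * Fintype.card O) ^ L := by
    simp [add_comm]
  rw [← hcard]
  -- Decoding. If slots conflict, an arbitrary label is chosen; this is harmless, as only the
  -- existence of a code for every sparse column is used.
  let F : (Fin L → Option (Fin M × O)) → Fin M → Option O := fun w j =>
    if h : ∃ o, ∃ k, w k = some (j, o) then some h.choose else none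
  have hF : ∀ g : SparseColumn M L O, ∃ w, F w = g.1 := by
    rintro ⟨g, hg⟩
    set S := Finset.univ.filter fun j => (g j).isSome = true
    obtain ⟨emb⟩ : Nonempty (S ↪ Fin L) :=
      Function.Embedding.nonempty_of_card_le (by simpa using hg)
    have hinv := emb.injective.isPartialInv
    have hsome : ∀ s : S, (g s).isSome = true := fun s => (Finset.mem_filter.1 s.2).2
    obtain ⟨w, hw⟩ : ∃ w : Fin L → Option (Fin M × O), ∀ j o,
        (∃ k, w k = some (j, o)) ↔ g j = some o := by
      refine ⟨fun k => (Function.partialInv emb k).map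
        fun s : S => ((s : Fin M), (g s).get (hsome s)), fun j o => ⟨?_, fun hj => ?_⟩⟩
      · rintro ⟨k, hk⟩
        obtain ⟨s, -, hs⟩ := Option.map_eq_some_iff.1 hk
        obtain ⟨rfl, rfl⟩ := Prod.mk.inj hs
        exact (Option.some_get _).symm
      · have hjS : j ∈ S := Finset.mem_filter.2 ⟨Finset.mem_univ _, by simp [hj]⟩
        refine ⟨emb ⟨j, hjS⟩, ?_⟩
        dsimp only
        rw [(hinv ⟨j, hjS⟩ _).2 rfl]
        simp [hj]
    refine ⟨w, funext fun j => ?_⟩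
    simp only [F, hw]
    split_ifs with hex
    · exact hex.choose_spec.symm
    · cases hj : g j with
      | none => rfl
      | some o => exact (hex ⟨o, hj⟩).elim
  choose w hw using hF
  exact Fintype.card_le_of_injective w fun g g' hgg => Subtype.ext (by rw [← hw g, ← hw g', hgg])

end SparseColumns

/-! ### The compressed operator as a PEPO -/

namespace EdgeInteraction

variable {V : Type*} [Fintype V] [DecidableEq V] {G : SimpleGraph V} [DecidableRel G.Adj]
  {d : ℕ} (h : EdgeInteraction G d) {K : ℕ} (ord : Fin K ≃ G.edgeSet)

theorem exists_smallOp_eq_sum (β : ℝ) (M : ℕ) (e : G.edgeSet) :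
    ∃ Y : Fin d × Fin d → V → Matrix (Fin d) (Fin d) ℂ,
      (∀ a w, w ∉ (e : Sym2 V) → Y a w = 1) ∧ h.smallOp β M e = ∑ a, productOp (Y a) := by
  obtain ⟨⟨u, v⟩, he⟩ := e
  exact exists_sum_productOp_of_actsOn (G.ne_of_adj he)
    (trotterFactor_actsOn (h.actsOn ⟨s(u, v), he⟩) _)

/-- A local operator at every vertex: the identity, or one term of the product decomposition. -/
def optionOp {O : Type*} (Y : O → V → Matrix (Fin d) (Fin d) ℂ) :
    Option O → V → Matrix (Fin d) (Fin d) ℂ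
  | none => 1
  | some a => Y a

/-- The two columns that belong to an edge. -/
def columnEquiv : Fin (K + K) ≃ G.edgeSet ⊕ G.edgeSet :=
  finSumFinEquiv.symm.trans (Equiv.sumCongr (Fin.revPerm.trans ord) ord)

theorem column_eq (i : Fin (K + K)) : column ord i = Sum.elim id id (columnEquiv ord i) := by
  refine Fin.addCases (fun i => ?_) (fun i => ?_) i <;>
    simp [column, columnEquiv, -Fin.natAdd_eq_addNat]

/-- The labelled table encoded in a choice of two labelled columns for every edge. -/
def labelledTable {M L : ℕ} {O : Type*} (α : G.edgeSet → SparseColumn M L O × SparseColumn M L O)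
    (j : Fin M) (i : Fin (K + K)) : Option O :=
  Sum.elim (fun e => (α e).1.1 j) (fun e => (α e).2.1 j) (columnEquiv ord i)

/-- The cut-off constrains each column separately, so the admissible labelled tables form a product
over the edges, two columns to each. This is what lets the sum be read as a sum over bond indices.
-/
theorem sum_labelledTable {M L : ℕ} {O B : Type*} [Fintype O] [DecidableEq O] [AddCommMonoid B]
    (Φ : (Fin M → Fin (K + K) → Option O) → B) :
    ∑ f with (∀ i, (Finset.univ.filter fun j => (f j i).isSome = true).card ≤ L), Φ f =
      ∑ α : G.edgeSet → SparseColumn M L O × SparseColumn M L O, Φ (labelledTable ord α) := by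
  symm
  refine Finset.sum_bij (fun α _ => labelledTable ord α) ?_ ?_ ?_ (fun _ _ => rfl)
  · intro α _
    refine Finset.mem_filter.2 ⟨Finset.mem_univ _, fun i => ?_⟩
    unfold labelledTable
    rcases columnEquiv ord i with e | e
    · exact (α e).1.2
    · exact (α e).2.2
  · intro α _ α' _ hαα
    funext e
    refine Prod.ext (Subtype.ext ?_) (Subtype.ext ?_)
    · funext j
      have := congrFun (congrFun hαα j) ((columnEquiv ord).symm (Sum.inl e))
      simpa [labelledTable] using this
    · funext j
      have := congrFun (congrFun hαα j) ((columnEquiv ord).symm (Sum.inr e))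
      simpa [labelledTable] using this
  · intro f hf
    have hf := (Finset.mem_filter.1 hf).2
    refine ⟨fun e => (⟨fun j => f j ((columnEquiv ord).symm (Sum.inl e)), hf _⟩,
      ⟨fun j => f j ((columnEquiv ord).symm (Sum.inr e)), hf _⟩), Finset.mem_univ _, ?_⟩
    funext j i
    obtain ⟨x, rfl⟩ := (columnEquiv ord).symm.surjective i
    rcases x with e | e <;> simp [labelledTable]

/-- Each entry `true` of a table is refined to one of the $d^2$ labels of a product term and `false`
to `none`. The cut-off depends only on which entries are filled, so it survives the refinement. -/
theorem compressedTrotter_eq_sum_productOp (β : ℝ) (M L : ℕ)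
    {Y : G.edgeSet → Fin d × Fin d → V → Matrix (Fin d) (Fin d) ℂ}
    (hY : ∀ e, h.smallOp β M e = ∑ a, productOp (Y e a)) :
    h.compressedTrotter ord β M L =
      ∑ α : G.edgeSet → SparseColumn M L (Fin d × Fin d) × SparseColumn M L (Fin d × Fin d),
        productOp (List.ofFn fun j => (List.ofFn fun i =>
          optionOp (Y (column ord i)) (labelledTable ord α j i)).prod).prod := by
  rw [← sum_labelledTable ord fun f => productOp (List.ofFn fun j => (List.ofFn fun i =>
          optionOp (Y (column ord i)) (f j i)).prod).prod]
  have hcell : ∀ (i : Fin (K + K)) (b : Bool),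
      (if b = true then h.smallOp β M (column ord i) else 1) =
        ∑ o ∈ Finset.univ.filter (fun o : Option (Fin d × Fin d) => o.isSome = b),
          productOp (optionOp (Y (column ord i)) o) := by
    intro i b
    rw [Finset.sum_filter, Fintype.sum_option]
    cases b <;> simp [optionOp, hY, productOp.map_one]
  have htab : ∀ t : Fin M → Fin (K + K) → Bool,
      (List.ofFn fun j => (List.ofFn fun i =>
        if t j i = true then h.smallOp β M (column ord i) else 1).prod).prod =
      ∑ f : Fin M → Fin (K + K) → Option (Fin d × Fin d) with (fun j i => (f j i).isSome) = t,
        productOp (List.ofFn fun j => (List.ofFn fun i =>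
          optionOp (Y (column ord i)) (f j i)).prod).prod := by
    intro t
    simp_rw [hcell, List.prod_ofFn_sum]
    refine Finset.sum_congr ?_ fun f _ => ?_
    · ext f
      simp [Fintype.mem_piFinset, funext_iff]
    · simp only [map_list_prod, List.map_ofFn, Function.comp_def]
  rw [compressedTrotter, Finset.sum_congr rfl fun t _ => htab t]
  rw [← Finset.sum_fiberwise_of_maps_to (s := Finset.univ.filter
      fun f : Fin M → Fin (K + K) → Option (Fin d × Fin d) =>
        ∀ i, (Finset.univ.filter fun j => (f j i).isSome = true).card ≤ L)
    (t := Finset.univ.filter fun t : Fin M → Fin (K + K) → Bool =>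
      ∀ i, (Finset.univ.filter fun j => t j i = true).card ≤ L)
    (g := fun f j i => (f j i).isSome)]
  · refine Finset.sum_congr rfl fun t ht => Finset.sum_congr ?_ fun _ _ => rfl
    ext f
    simp only [Finset.mem_filter, Finset.mem_univ, true_and]
    constructor
    · rintro rfl
      exact ⟨(Finset.mem_filter.1 ht).2, rfl⟩
    · exact fun hf => hf.2
  · intro f hf
    exact Finset.mem_filter.2 ⟨Finset.mem_univ _, (Finset.mem_filter.1 hf).2⟩

/-- The bond dimension of the compressed Trotter operator. -/
def bondDim (d M L : ℕ) : ℕ :=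
  Fintype.card (SparseColumn M L (Fin d × Fin d) × SparseColumn M L (Fin d × Fin d))

theorem bondDim_le (d M L : ℕ) : bondDim d M L ≤ (1 + M * d ^ 2) ^ (2 * L) := by
  have h := card_sparseColumn_le (M := M) (L := L) (O := Fin d × Fin d)
  rw [Fintype.card_prod, Fintype.card_fin, ← sq] at h
  rw [bondDim, Fintype.card_prod, two_mul, pow_add]
  exact Nat.mul_le_mul h h

/-- The product terms for `e` are the identity away from `e`, so the factor at a vertex depends only
on the columns of the edges meeting it. The bond index at an edge is its pair of sparse labelled
columns. -/
theorem isPEPO_compressedTrotter (β : ℝ) (M L : ℕ) :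
    IsPEPO G (bondDim d M L) (h.compressedTrotter ord β M L) := by
  choose Y hY1 hY using h.exists_smallOp_eq_sum β M
  refine IsPEPO.of_fintype (fun v a => (List.ofFn fun j => (List.ofFn fun i =>
    Sum.elim
      (fun e : G.edgeSet => if hv : v ∈ (e : Sym2 V) then
        optionOp (Y e) ((a ⟨e, hv⟩).1.1 j) v else 1)
      (fun e : G.edgeSet => if hv : v ∈ (e : Sym2 V) then
        optionOp (Y e) ((a ⟨e, hv⟩).2.1 j) v else 1)
      (columnEquiv ord i)).prod).prod) ?_
  rw [h.compressedTrotter_eq_sum_productOp ord β M L hY]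
  refine Finset.sum_congr rfl fun α _ => ?_
  congr 1
  funext v
  have hev : ∀ l : List (V → Matrix (Fin d) (Fin d) ℂ),
      l.prod v = (l.map fun Z => Z v).prod := fun l =>
    map_list_prod (Pi.evalMonoidHom (fun _ : V => Matrix (Fin d) (Fin d) ℂ) v) l
  simp only [hev, List.map_ofFn, Function.comp_def]
  congr 2
  funext j
  congr 2
  funext i
  have hnot : ∀ (e : G.edgeSet) (o : Option (Fin d × Fin d)), v ∉ (e : Sym2 V) →
      optionOp (Y e) o v = 1 := by
    intro e o hv
    cases o with
    | none => rfl
    | some a => exact hY1 e a v hv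
  rw [column_eq]
  unfold labelledTable
  rcases columnEquiv ord i with e | e
  · by_cases hv : v ∈ (e : Sym2 V)
    · simp [hv]
    · simp [hv, hnot e _ hv]
  · by_cases hv : v ∈ (e : Sym2 V)
    · simp [hv]
    · simp [hv, hnot e _ hv]

end EdgeInteraction

/-! ### From a PEPO near the projector to a PEPS near a ground state -/

/-- Normalising two vectors of small relative distance. -/
theorem norm_normalize_sub_normalize_le {E : Type*} [NormedAddCommGroup E] [NormedSpace ℝ E]
    {x p : E} {δ : ℝ} (hp : p ≠ 0) (hδ : δ < 1) (hxp : ‖x - p‖ ≤ δ * ‖p‖) :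
    x ≠ 0 ∧ ‖‖x‖⁻¹ • x - ‖p‖⁻¹ • p‖ ≤ 2 * δ := by
  have hp0 : 0 < ‖p‖ := norm_pos_iff.2 hp
  have habs := (abs_norm_sub_norm_le x p).trans hxp
  have hx0 : 0 < ‖x‖ := by
    have := (abs_le.1 habs).1
    nlinarith
  refine ⟨norm_pos_iff.1 hx0, ?_⟩
  have e : ‖x‖⁻¹ • x - ‖p‖⁻¹ • p = (‖x‖⁻¹ - ‖p‖⁻¹) • x + ‖p‖⁻¹ • (x - p) := by
    rw [sub_smul, smul_sub]
    abel
  rw [e, two_mul]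
  refine (norm_add_le _ _).trans (add_le_add ?_ ?_)
  · rw [norm_smul, Real.norm_eq_abs]
    have : |‖x‖⁻¹ - ‖p‖⁻¹| * ‖x‖ = |‖x‖ - ‖p‖| / ‖p‖ := by
      rw [inv_sub_inv hx0.ne' hp0.ne', abs_div, abs_of_pos (mul_pos hx0 hp0), abs_sub_comm]
      field_simp
    rwa [this, div_le_iff₀ hp0]
  · rw [norm_smul, norm_inv, norm_norm, inv_mul_eq_div, div_le_iff₀ hp0]
    exact hxp

theorem ApproxByPEPS.smul {V : Type*} [Fintype V] [DecidableEq V] [Nonempty V]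
    {G : SimpleGraph V} [DecidableRel G.Adj] {d D : ℕ} {ε : ℝ} {ψ : SpinVec V d}
    (hψ : ApproxByPEPS G D ε ψ) {c : ℂ} (hc : ‖c‖ = 1) : ApproxByPEPS G D ε (c • ψ) := by
  obtain ⟨φ, h1, h2, h3⟩ := hψ
  refine ⟨c • φ, h1.smul c, by rw [norm_smul, hc, h2, one_mul], ?_⟩
  rw [← smul_sub, norm_smul, hc, one_mul]
  exact h3

namespace EdgeInteraction

variable {V : Type*} [Fintype V] [DecidableEq V] {G : SimpleGraph V} [DecidableRel G.Adj]
  {d : ℕ} (h : EdgeInteraction G d)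

theorem groundProjector_col_mem (τ : V → Fin d) :
    (WithLp.toLp 2 fun σ => h.groundProjector σ τ : SpinVec V d) ∈ h.groundSpace := by
  have h1 : (WithLp.toLp 2 fun σ => h.groundProjector σ τ : SpinVec V d) =
      Matrix.toEuclideanCLM (𝕜 := ℂ) h.groundProjector (WithLp.toLp 2 (Pi.single τ 1)) := by
    rw [Matrix.toEuclideanCLM_toLp, Matrix.mulVec_single_one]
    rfl
  rw [h1, groundProjector, StarAlgEquiv.apply_symm_apply]
  exact Submodule.starProjection_apply_mem _ _

theorem sum_norm_sq_groundProjector :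
    ∑ σ, ∑ τ, ‖h.groundProjector σ τ‖ ^ 2 = h.degeneracy := by
  have h1 : h.groundProjector.conjTranspose * h.groundProjector = h.groundProjector := by
    rw [groundProjector_eq_spectralMatrix, Matrix.IsHermitian.spectralMatrix_conjTranspose,
      Matrix.IsHermitian.spectralMatrix_mul]
    congr 1
    funext i
    simp only [groundIndicator, Pi.mul_apply, Pi.star_apply]
    split_ifs <;> simp
  have h2 : ((∑ σ, ∑ τ, ‖h.groundProjector σ τ‖ ^ 2 : ℝ) : ℂ) =
      (h.groundProjector.conjTranspose * h.groundProjector).trace := by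
    rw [Finset.sum_comm]
    simp [Matrix.trace, Matrix.mul_apply, Complex.conj_mul']
  rw [h1, trace_groundProjector] at h2
  exact_mod_cast h2

/-- A PEPO close to the ground state projector maps some product vector close to a ground
state. -/
theorem exists_approxByPEPS (hd : 0 < d) [Nonempty V] {A : SpinOp V d} {D : ℕ} {δ ε : ℝ}
    (hA : IsPEPO G D A) (hδ : δ < 1) (hδε : 2 * δ ≤ ε)
    (hAP : traceNorm (A - h.groundProjector) ≤ δ) :
    ∃ ψ ∈ h.groundSpace, ‖ψ‖ = 1 ∧ ApproxByPEPS G D ε ψ := by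
  set P := h.groundProjector with hP
  set x : (V → Fin d) → SpinVec V d := fun τ => WithLp.toLp 2 fun σ => A σ τ with hx
  set p : (V → Fin d) → SpinVec V d := fun τ => WithLp.toLp 2 fun σ => P σ τ with hp
  have hδ0 : 0 ≤ δ := (traceNorm_nonneg _).trans hAP
  have hsum1 : ∑ τ, ‖x τ - p τ‖ ^ 2 ≤ δ ^ 2 := by
    have h1 : ∑ τ, ‖x τ - p τ‖ ^ 2 = ∑ σ, ∑ τ, ‖(A - P) σ τ‖ ^ 2 := by
      rw [Finset.sum_comm]
      refine Finset.sum_congr rfl fun τ _ => ?_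
      rw [EuclideanSpace.norm_sq_eq]
      rfl
    rw [h1]
    exact (sum_norm_sq_le_traceNorm_sq _).trans (pow_le_pow_left₀ (traceNorm_nonneg _) hAP 2)
  have hsum2 : ∑ τ, ‖p τ‖ ^ 2 = h.degeneracy := by
    rw [← h.sum_norm_sq_groundProjector, Finset.sum_comm]
    exact Finset.sum_congr rfl fun τ _ => EuclideanSpace.norm_sq_eq _
  have hdeg : (1 : ℝ) ≤ h.degeneracy := Nat.one_le_cast.2 (h.one_le_degeneracy hd)
  set s := Finset.univ.filter fun τ => p τ ≠ 0 with hs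
  have hsum3 : ∑ τ ∈ s, ‖p τ‖ ^ 2 = h.degeneracy := by
    rw [← hsum2]
    refine Finset.sum_subset (Finset.subset_univ s) fun τ _ hτ => ?_
    have : p τ = 0 := by simpa [hs] using hτ
    simp [this]
  have hne : s.Nonempty := by
    by_contra hcon
    rw [Finset.not_nonempty_iff_eq_empty.1 hcon, Finset.sum_empty] at hsum3
    linarith
  -- Averaging: the squared column errors sum to at most $\delta^2$, while the $\|p_\tau\|^2$ sum to
  -- the degeneracy, which is at least `1`. Restriction to `s` guarantees that the chosen column of
  -- the projector can be normalised.
  obtain ⟨τ, hτs, hτ⟩ : ∃ τ ∈ s, ‖x τ - p τ‖ ^ 2 ≤ δ ^ 2 * ‖p τ‖ ^ 2 := by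
    refine Finset.exists_le_of_sum_le hne ?_
    rw [← Finset.mul_sum, hsum3]
    have h1 : ∑ τ ∈ s, ‖x τ - p τ‖ ^ 2 ≤ ∑ τ, ‖x τ - p τ‖ ^ 2 :=
      Finset.sum_le_sum_of_subset_of_nonneg (Finset.subset_univ s) fun _ _ _ => by positivity
    nlinarith [sq_nonneg δ]
  have hpτ : p τ ≠ 0 := (Finset.mem_filter.1 hτs).2
  rw [← mul_pow] at hτ
  obtain ⟨hx0, hle⟩ := norm_normalize_sub_normalize_le hpτ hδ
    (pow_le_pow_iff_left₀ (norm_nonneg _) (by positivity) two_ne_zero |>.1 hτ)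
  have hsm : ∀ (r : ℝ) (v : SpinVec V d), r • v = (r : ℂ) • v := fun r v =>
    (Complex.coe_smul r v).symm
  have hunit : ∀ v : SpinVec V d, v ≠ 0 → ‖‖v‖⁻¹ • v‖ = 1 := fun v hv => by
    rw [norm_smul, norm_inv, norm_norm, inv_mul_cancel₀ (norm_ne_zero_iff.2 hv)]
  refine ⟨‖p τ‖⁻¹ • p τ, ?_, hunit _ hpτ, ‖x τ‖⁻¹ • x τ, ?_, hunit _ hx0, hle.trans hδε⟩
  · rw [hsm]
    exact h.groundSpace.smul_mem _ (h.groundProjector_col_mem τ)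
  · rw [hsm]
    exact (hA.isPEPS_col τ).smul _

/-- Unit vectors of a one-dimensional space differ by a phase, which can be moved into the PEPS. -/
theorem approxByPEPS_of_finrank_eq_one [Nonempty V] {D : ℕ} {ε : ℝ}
    (hex : ∃ ψ ∈ h.groundSpace, ‖ψ‖ = 1 ∧ ApproxByPEPS G D ε ψ)
    (hrank : Module.finrank ℂ h.groundSpace = 1) :
    ∀ ψ ∈ h.groundSpace, ‖ψ‖ = 1 → ApproxByPEPS G D ε ψ := by
  obtain ⟨ψ₀, h0, h1, h2⟩ := hex
  intro ψ hψ hn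
  have hne : (⟨ψ₀, h0⟩ : h.groundSpace) ≠ 0 := by
    intro hcon
    have : ψ₀ = 0 := congrArg Subtype.val hcon
    rw [this, norm_zero] at h1
    exact zero_ne_one h1
  obtain ⟨c, hc⟩ := (finrank_eq_one_iff_of_nonzero' _ hne).1 hrank ⟨ψ, hψ⟩
  have hc' : c • ψ₀ = ψ := congrArg Subtype.val hc
  rw [← hc'] at hn ⊢
  rw [norm_smul, h1, mul_one] at hn
  exact h2.smul hn

theorem one_add_pow_sub_one_le {θ : ℝ} (hθ : 0 ≤ θ) (n : ℕ) (hn : n * θ ≤ 1) :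
    (1 + θ) ^ n - 1 ≤ 2 * (n * θ) := by
  have h1 : (1 + θ) ^ n ≤ Real.exp (n * θ) := by
    rw [Real.exp_nat_mul]
    gcongr
    linarith [Real.add_one_le_exp θ]
  have h0 : 0 ≤ n * θ := by positivity
  have h2 := Real.abs_exp_sub_one_le (x := n * θ) (by rwa [abs_of_nonneg h0])
  rw [abs_of_nonneg h0] at h2
  linarith [le_abs_self (Real.exp (n * θ) - 1)]

/-- Sufficient conditions on the parameters of the Trotter/compression construction. -/
theorem groundStateApproximation_of_le (hd : 0 < d) [Nonempty V] {K : ℕ}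
    (ord : Fin K ≃ G.edgeSet) {β δ ε W : ℝ} {M L : ℕ} (hβ : 0 ≤ β) (hM : 0 < M)
    (hδ0 : 0 < δ) (hδ1 : δ < 1) (hδε : 2 * δ ≤ ε) (hexc : h.excitedWeight β ≤ δ / 2)
    (hW : h.degeneracy + h.excitedWeight β ≤ W) (hMβ : 2 * β * K ≤ M)
    (hMW : 48 * β ^ 2 * K ^ 2 * W ≤ δ * M)
    (hLW : 48 * K * W * Real.exp (7 * β) ≤ δ * 2 ^ L) :
    h.GroundStateApproximation ord ε β M L (bondDim d M L) := by
  have hM0 : (0 : ℝ) < M := by exact_mod_cast hM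
  have hdeg : (1 : ℝ) ≤ h.degeneracy := Nat.one_le_cast.2 (h.one_le_degeneracy hd)
  have hexc0 := h.excitedWeight_nonneg β
  have hW1 : 1 ≤ W := by linarith
  set y := 4 * β ^ 2 * K ^ 2 / M with hy
  set θ := (1 / 2 : ℝ) ^ L * Real.exp (7 * β) with hθ
  have hy0 : 0 ≤ y := by positivity
  have hθ0 : 0 ≤ θ := by positivity
  have hyW : 12 * (W * y) ≤ δ := by
    have : 12 * (W * y) = 48 * β ^ 2 * K ^ 2 * W / M := by
      rw [hy]
      ring
    rwa [this, div_le_iff₀ hM0]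
  have hθW : 12 * (W * (2 * (((K + K : ℕ) : ℝ) * θ))) ≤ δ := by
    have : 12 * (W * (2 * (((K + K : ℕ) : ℝ) * θ))) = 48 * K * W * Real.exp (7 * β) / 2 ^ L := by
      rw [hθ, one_div, inv_pow]
      push_cast
      field_simp
      ring
    rwa [this, div_le_iff₀ (by positivity)]
  have hy1 : y ≤ 1 := by nlinarith
  have hKθ0 : 0 ≤ ((K + K : ℕ) : ℝ) * θ := by positivity
  have hKθ1 : ((K + K : ℕ) : ℝ) * θ ≤ 1 := by nlinarith
  have hpow := one_add_pow_sub_one_le hθ0 (K + K) hKθ1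
  have hpow0 : 0 ≤ (1 + θ) ^ (K + K) - 1 := sub_nonneg.2 (one_le_pow₀ (by linarith))
  have hey : Real.exp y ≤ 3 := (Real.exp_le_exp.2 hy1).trans Real.exp_one_lt_three.le
  have hpepo : IsPEPO G (bondDim d M L)
      ((Real.exp (β * h.groundEnergy) : ℂ) • h.compressedTrotter ord β M L) :=
    (h.isPEPO_compressedTrotter ord β M L).smul _
  have htn : traceNorm ((Real.exp (β * h.groundEnergy) : ℂ) • h.compressedTrotter ord β M L
      - h.groundProjector) ≤ δ := by
    refine traceNorm_le_of_forall fun U hU => ?_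
    refine (h.norm_trace_mul_rescaled_compressedTrotter_sub_le ord hd hβ hM hMβ L hU).trans ?_
    have : (h.degeneracy + h.excitedWeight β) *
        (Real.exp y * ((1 + θ) ^ (K + K) - 1 + y)) ≤
        W * (3 * (2 * (((K + K : ℕ) : ℝ) * θ) + y)) := by
      gcongr
    -- The `3` bounds $e^y$. Compression and Trotter error cost at most $\delta/4$ each, and the
    -- remaining $\delta/2$ is left for the excited states.
    have e : W * (3 * (2 * (((K + K : ℕ) : ℝ) * θ) + y)) =
      (12 * (W * (2 * (((K + K : ℕ) : ℝ) * θ))) + 12 * (W * y)) / 4 := by ring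
    linarith
  have hex := h.exists_approxByPEPS hd hpepo hδ1 hδε htn
  refine ⟨?_, hpepo, by linarith, hex, h.approxByPEPS_of_finrank_eq_one hex⟩
  have := h.traceNorm_gibbs_sub_le hd β
  linarith

theorem GroundStateApproximation.mono {h : EdgeInteraction G d} {K : ℕ}
    {ord : Fin K ≃ G.edgeSet} {ε ε' β : ℝ} {M L D : ℕ} (hε : ε ≤ ε')
    (H : h.GroundStateApproximation ord ε β M L D) :
    h.GroundStateApproximation ord ε' β M L D := by
  obtain ⟨h1, h2, h3, ⟨ψ, h4, h5, φ, h6, h7, h8⟩, h9⟩ := H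
  refine ⟨h1.trans hε, h2, h3.trans hε, ⟨ψ, h4, h5, φ, h6, h7, h8.trans hε⟩, fun hr ψ hψ hn => ?_⟩
  obtain ⟨φ, h6, h7, h8⟩ := h9 hr ψ hψ hn
  exact ⟨φ, h6, h7, h8.trans hε⟩

/-- On a single vertex there is no interaction, and the construction is exact. -/
theorem groundStateApproximation_of_card_eq_one (hd : 0 < d) (hV : Fintype.card V = 1)
    (ord : Fin (Fintype.card G.edgeSet) ≃ G.edgeSet) {ε : ℝ} (hε : 0 < ε) :
    h.GroundStateApproximation ord ε 0 1 0 (bondDim d 1 0) := by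
  have : Subsingleton V := Fintype.card_le_one_iff_subsingleton.1 hV.le
  have : Nonempty V := Fintype.card_pos_iff.1 (by omega)
  have hempty : IsEmpty G.edgeSet := ⟨fun ⟨e, he⟩ => by
    induction e with
    | h u v => exact G.ne_of_adj he (Subsingleton.elim u v)⟩
  have hK : Fintype.card G.edgeSet = 0 := Fintype.card_eq_zero
  have hH : h.hamiltonian = 0 := by rw [hamiltonian, Finset.univ_eq_empty, Finset.sum_empty]
  have hen : ∀ i, h.energy i = 0 := fun i =>
    congrFun (h.isHermitian_hamiltonian.eigenvalues_eq_zero_iff.2 hH) i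
  have hg : h.groundEnergy = 0 := by
    obtain ⟨i, hi⟩ := h.exists_energy_eq_groundEnergy hd
    rw [← hi, hen]
  have hexc : h.excitedWeight 0 = 0 := by
    rw [excitedWeight, Finset.filter_false_of_mem, Finset.sum_empty]
    intro i _
    simp [hen, hg]
  refine (h.groundStateApproximation_of_le hd ord (δ := min ε 1 / 2) (ε := min ε 1)
    (W := h.degeneracy) le_rfl one_pos (by positivity) ?_ (by linarith) ?_ ?_ ?_ ?_ ?_).mono
    (min_le_left _ _)
  · have := min_le_right ε 1
    linarith
  · rw [hexc]
    positivity
  · rw [hexc, add_zero]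
  · simp
  · simp
    positivity
  · rw [hK]
    simp
    positivity

end EdgeInteraction

/-! ### Choice of the parameters -/

/-- A constant is dominated by an exponential in any quantity bounded below by `log 2`. -/
theorem le_exp_log_div_log_two_mul {x Λ : ℝ} (hx : 1 ≤ x) (hΛ : Real.log 2 ≤ Λ) :
    x ≤ Real.exp (Real.log x / Real.log 2 * Λ) := by
  have h2 : 0 < Real.log 2 := Real.log_pos one_lt_two
  conv_lhs => rw [← Real.exp_log (by linarith : 0 < x)]
  gcongr
  rw [div_mul_eq_mul_div, le_div_iff₀ h2]
  exact mul_le_mul_of_nonneg_left hΛ (Real.log_nonneg hx)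

theorem two_pow_le_exp {Λ : ℝ} (hΛ : Real.log 2 ≤ Λ) (n : ℕ) : (2 : ℝ) ^ n ≤ Real.exp (n * Λ) := by
  rw [Real.exp_nat_mul]
  gcongr
  rw [← Real.log_le_iff_le_exp two_pos]
  exact hΛ

theorem card_edgeSet_le {V : Type*} [Fintype V] [DecidableEq V] (G : SimpleGraph V)
    [DecidableRel G.Adj] {z : ℕ} (hz : ∀ v, G.degree v ≤ z) :
    Fintype.card G.edgeSet ≤ z * Fintype.card V := by
  have h1 := G.sum_degrees_eq_twice_card_edges
  have h2 : ∑ v, G.degree v ≤ ∑ _v : V, z := Finset.sum_le_sum fun v _ => hz v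
  rw [Finset.sum_const, Finset.card_univ, smul_eq_mul] at h2
  rw [← SimpleGraph.edgeFinset_card, mul_comm]
  omega

set_option maxHeartbeats 400000 in
/-- The choice of inverse temperature, Trotter number and cut-off. -/
theorem exists_trotter_parameters (d z : ℕ) (hd : 0 < d) (Δ c p q : ℝ) (hΔ : 0 < Δ)
    (hc : 1 ≤ c) (hp : 0 ≤ p) (hq : 0 ≤ q) :
    ∃ C : ℝ, 0 < C ∧ ∀ (N ε : ℝ) (K : ℕ), 2 ≤ N → 0 < ε → ε < 1 → (K : ℝ) ≤ z * N →
      ∃ (β W : ℝ) (M L : ℕ), 0 ≤ β ∧ 0 < M ∧ β ≤ C * Real.log (N / ε) ∧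
        (1 + (M : ℝ) * d ^ 2) ^ (2 * L) ≤ Real.exp (C * Real.log (N / ε) ^ 2) ∧
        (c * N) ^ (2 * p * Δ + q) * Real.exp (-(β * Δ)) ≤ ε / 8 ∧ (c * N) ^ q + 1 ≤ W ∧
        2 * β * K ≤ M ∧ 48 * β ^ 2 * K ^ 2 * W ≤ ε / 2 * M ∧
        48 * K * W * Real.exp (7 * β) ≤ ε / 2 * 2 ^ L := by
  have hlog2 : 0 < Real.log 2 := Real.log_pos one_lt_two
  have hd1 : (1 : ℝ) ≤ d := by exact_mod_cast hd
  -- All quantities are measured as exponents of $e^\Lambda=N/\varepsilon$: $cN\le e^{c_1\Lambda}$,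
  -- $K\le e^{\kappa\Lambda}$, $\beta=b\Lambda$, $W=e^{w\Lambda}$, $M=\lceil e^{m\Lambda}\rceil$,
  -- $L=\lceil2l\Lambda\rceil$ and $1+Md^2\le e^{g\Lambda}$. Since $\Lambda\ge\log2$, a factor $2^j$
  -- costs $j$ in the exponent and a factor $\varepsilon$ costs `1`. Thus the `4` in `b` pays for
  -- $\varepsilon/8$, and the `8` in `m` and `l` for $\varepsilon$ and $48\le2^7/2$.
  obtain ⟨c₁, hc₁⟩ : ∃ x, x = 1 + Real.log c / Real.log 2 := ⟨_, rfl⟩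
  obtain ⟨κ, hκ⟩ : ∃ x, x = 1 + Real.log (z + 1) / Real.log 2 := ⟨_, rfl⟩
  obtain ⟨b, hb⟩ : ∃ x, x = (c₁ * (2 * p * Δ + q) + 4) / Δ := ⟨_, rfl⟩
  obtain ⟨w, hw⟩ : ∃ x, x = c₁ * q + 1 := ⟨_, rfl⟩
  obtain ⟨m, hm⟩ : ∃ x, x = 8 + 2 * b + 2 * κ + w := ⟨_, rfl⟩
  obtain ⟨l, hl⟩ : ∃ x, x = 8 + κ + w + 7 * b := ⟨_, rfl⟩
  obtain ⟨g, hg⟩ : ∃ x, x = m + 2 + 2 * (Real.log d / Real.log 2) := ⟨_, rfl⟩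
  have hc₁0 : 0 ≤ c₁ := by
    have := Real.log_nonneg hc
    rw [hc₁]
    positivity
  have hκ0 : 0 ≤ κ := by
    have : 0 ≤ Real.log ((z : ℝ) + 1) := Real.log_nonneg (by linarith [Nat.cast_nonneg (α := ℝ) z])
    rw [hκ]
    positivity
  have hb0 : 0 ≤ b := by
    rw [hb]
    positivity
  have hw0 : 0 ≤ w := by
    rw [hw]
    positivity
  have hm0 : 0 ≤ m := by
    rw [hm]
    positivity
  have hl0 : 0 ≤ l := by
    rw [hl]
    positivity
  have hg0 : 0 ≤ g := by
    have := Real.log_nonneg hd1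
    rw [hg]
    positivity
  refine ⟨1 + b + g * (4 * l + 4), by positivity, ?_⟩
  intro N ε K hN2 hε hε1 h1
  obtain ⟨Λ, hΛ⟩ : ∃ x, x = Real.log (N / ε) := ⟨_, rfl⟩
  rw [← hΛ]
  have hNε : 2 ≤ N / ε := by
    rw [le_div_iff₀ hε]
    nlinarith
  have hΛ2 : Real.log 2 ≤ Λ := hΛ ▸ Real.log_le_log two_pos hNε
  have hΛ0 : 0 < Λ := hlog2.trans_le hΛ2
  have hΛhalf : 1 / 2 ≤ Λ := by linarith [Real.log_two_gt_d9]
  have hexpΛ : Real.exp Λ = N / ε := hΛ ▸ Real.exp_log (by linarith)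
  have hNexp : N ≤ Real.exp Λ := by
    rw [hexpΛ, le_div_iff₀ hε]
    nlinarith
  have hεexp : Real.exp (-Λ) ≤ ε := by
    rw [Real.exp_neg, hexpΛ, inv_div]
    exact div_le_self hε.le (by linarith)
  have hX1 : 1 ≤ c * N := by nlinarith
  have hX : c * N ≤ Real.exp (c₁ * Λ) := by
    rw [hc₁, add_mul, one_mul, add_comm, Real.exp_add]
    have := le_exp_log_div_log_two_mul hc hΛ2
    gcongr
  have hKexp : (K : ℝ) ≤ Real.exp (κ * Λ) := by
    have h2 := le_exp_log_div_log_two_mul (x := (z : ℝ) + 1)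
      (by linarith [Nat.cast_nonneg (α := ℝ) z]) hΛ2
    rw [hκ, add_mul, one_mul, add_comm, Real.exp_add]
    calc (K : ℝ) ≤ z * N := h1
      _ ≤ (z + 1) * N := by gcongr; linarith
      _ ≤ _ := by gcongr
  obtain ⟨β, hβ⟩ : ∃ x, x = b * Λ := ⟨_, rfl⟩
  have hβ0 : 0 ≤ β := by
    rw [hβ]
    positivity
  have hβexp : β ≤ Real.exp (b * Λ) := by
    rw [hβ]
    linarith [Real.add_one_le_exp (b * Λ)]
  obtain ⟨W, hW⟩ : ∃ x, x = Real.exp (w * Λ) := ⟨_, rfl⟩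
  have hW0 : 0 ≤ W := hW ▸ (Real.exp_pos _).le
  have hr : (c * N) ^ (2 * p * Δ + q) * Real.exp (-(β * Δ)) ≤ ε / 8 := by
    have h1 : (c * N) ^ (2 * p * Δ + q) ≤ Real.exp (c₁ * Λ * (2 * p * Δ + q)) := by
      rw [Real.exp_mul]
      exact Real.rpow_le_rpow (by linarith) hX (by positivity)
    have h2 : β * Δ = c₁ * Λ * (2 * p * Δ + q) + 4 * Λ := by
      rw [hβ, hb]
      field_simp
    have h3 := two_pow_le_exp hΛ2 3
    calc _ ≤ Real.exp (c₁ * Λ * (2 * p * Δ + q)) * Real.exp (-(β * Δ)) := by gcongr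
      _ = Real.exp (-Λ) * (Real.exp ((3 : ℕ) * Λ))⁻¹ := by
        rw [← Real.exp_neg, ← Real.exp_add, ← Real.exp_add, h2]
        push_cast
        ring_nf
      _ ≤ ε * ((2 : ℝ) ^ 3)⁻¹ := by gcongr
      _ = ε / 8 := by ring
  have hWbound : (c * N) ^ q + 1 ≤ W := by
    have h1 : (c * N) ^ q ≤ Real.exp (c₁ * q * Λ) := by
      rw [mul_right_comm, Real.exp_mul]
      exact Real.rpow_le_rpow (by linarith) hX hq
    have h2 : 1 ≤ Real.exp (c₁ * q * Λ) := Real.one_le_exp (by positivity)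
    have h3 := two_pow_le_exp hΛ2 1
    rw [pow_one, Nat.cast_one, one_mul] at h3
    rw [hW, hw, add_mul, one_mul, Real.exp_add]
    have h4 := mul_le_mul_of_nonneg_left h3 (Real.exp_pos (c₁ * q * Λ)).le
    linarith
  obtain ⟨M, hM⟩ : ∃ x, x = ⌈Real.exp (m * Λ)⌉₊ := ⟨_, rfl⟩
  have hM1 : Real.exp (m * Λ) ≤ M := hM ▸ Nat.le_ceil _
  have hMpos : 0 < M := hM ▸ Nat.ceil_pos.2 (Real.exp_pos _)
  have hM2 : (M : ℝ) ≤ Real.exp ((m + 1) * Λ) := by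
    have h1 := (Nat.ceil_lt_add_one (Real.exp_pos (m * Λ)).le).le
    rw [← hM] at h1
    have h2 : 1 ≤ Real.exp (m * Λ) := Real.one_le_exp (by positivity)
    have h3 := two_pow_le_exp hΛ2 1
    rw [pow_one, Nat.cast_one, one_mul] at h3
    rw [add_mul, one_mul, Real.exp_add]
    have h4 := mul_le_mul_of_nonneg_left h3 (Real.exp_pos (m * Λ)).le
    linarith
  obtain ⟨L, hL⟩ : ∃ x, x = ⌈2 * l * Λ⌉₊ := ⟨_, rfl⟩
  have hL1 : 2 * l * Λ ≤ L := hL ▸ Nat.le_ceil _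
  have hL2 : (L : ℝ) ≤ (2 * l + 2) * Λ := by
    have := (Nat.ceil_lt_add_one (show 0 ≤ 2 * l * Λ by positivity)).le
    rw [← hL] at this
    linarith
  refine ⟨β, W, M, L, hβ0, hMpos, ?_, ?_, hr, hWbound, ?_, ?_, ?_⟩
  · have : 0 ≤ g * (4 * l + 4) := by positivity
    rw [hβ]
    gcongr
    linarith
  · have hMone : (1 : ℝ) ≤ M := by exact_mod_cast hMpos
    have hd2 := le_exp_log_div_log_two_mul hd1 hΛ2
    have hbase : (1 : ℝ) + M * d ^ 2 ≤ Real.exp (g * Λ) := by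
      have h3 := two_pow_le_exp hΛ2 1
      rw [pow_one, Nat.cast_one, one_mul] at h3
      have e : Real.exp (g * Λ) = Real.exp Λ * (Real.exp ((m + 1) * Λ) *
          Real.exp (Real.log d / Real.log 2 * Λ) ^ 2) := by
        rw [← Real.exp_nat_mul, ← Real.exp_add, ← Real.exp_add, hg]
        push_cast
        ring_nf
      rw [e]
      calc (1 : ℝ) + M * d ^ 2 ≤ 2 * (M * d ^ 2) := by
            linarith [one_le_mul_of_one_le_of_one_le hMone (one_le_pow₀ (n := 2) hd1)]
        _ ≤ _ := by gcongr
    calc (1 + (M : ℝ) * d ^ 2) ^ (2 * L) ≤ Real.exp (g * Λ) ^ (2 * L) := by gcongr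
      _ = Real.exp (2 * L * (g * Λ)) := by rw [← Real.exp_nat_mul]; push_cast; rfl
      _ ≤ _ := by
        rw [Real.exp_le_exp]
        calc 2 * L * (g * Λ) ≤ 2 * ((2 * l + 2) * Λ) * (g * Λ) := by gcongr
          _ = g * (4 * l + 4) * Λ ^ 2 := by ring
          _ ≤ _ := by
            gcongr
            linarith
  · refine le_trans ?_ hM1
    have h3 := two_pow_le_exp hΛ2 1
    rw [pow_one] at h3
    calc 2 * β * K ≤ Real.exp ((1 : ℕ) * Λ) * Real.exp (b * Λ) * Real.exp (κ * Λ) := by gcongr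
      _ = Real.exp ((1 + b + κ) * Λ) := by
        rw [← Real.exp_add, ← Real.exp_add]
        push_cast
        ring_nf
      _ ≤ _ := by
        gcongr
        linarith
  · have h3 := two_pow_le_exp hΛ2 7
    calc 48 * β ^ 2 * K ^ 2 * W ≤ 2 ^ 7 / 2 * Real.exp (b * Λ) ^ 2 * Real.exp (κ * Λ) ^ 2 * W := by
          gcongr
          norm_num
      _ ≤ Real.exp ((7 : ℕ) * Λ) / 2 * Real.exp (b * Λ) ^ 2 * Real.exp (κ * Λ) ^ 2 * W := by
          gcongr
      _ = Real.exp (-Λ) / 2 * Real.exp (m * Λ) := by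
          rw [hW, ← Real.exp_nat_mul, ← Real.exp_nat_mul, div_mul_eq_mul_div, div_mul_eq_mul_div,
            div_mul_eq_mul_div, div_mul_eq_mul_div, ← Real.exp_add, ← Real.exp_add,
            ← Real.exp_add, ← Real.exp_add, hm]
          push_cast
          ring_nf
      _ ≤ ε / 2 * M := by gcongr
  · have h3 := two_pow_le_exp hΛ2 7
    -- The factor `2` in the definition of `L` compensates for the base: $\log2\ge1/2$.
    have hpow : Real.exp (l * Λ) ≤ 2 ^ L := by
      have e : (2 : ℝ) ^ L = Real.exp (L * Real.log 2) := by
        rw [Real.exp_nat_mul, Real.exp_log two_pos]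
      rw [e, Real.exp_le_exp]
      have : 1 / 2 ≤ Real.log 2 := by linarith [Real.log_two_gt_d9]
      calc l * Λ = 2 * l * Λ * (1 / 2) := by ring
        _ ≤ L * Real.log 2 := by gcongr
    calc 48 * K * W * Real.exp (7 * β) ≤
          2 ^ 7 / 2 * Real.exp (κ * Λ) * W * Real.exp (7 * β) := by
          gcongr
          norm_num
      _ ≤ Real.exp ((7 : ℕ) * Λ) / 2 * Real.exp (κ * Λ) * W * Real.exp (7 * β) := by gcongr
      _ = Real.exp (-Λ) / 2 * Real.exp (l * Λ) := by
          rw [hW, div_mul_eq_mul_div, div_mul_eq_mul_div,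
            div_mul_eq_mul_div, div_mul_eq_mul_div, ← Real.exp_add, ← Real.exp_add,
            ← Real.exp_add, ← Real.exp_add, hl, hβ]
          push_cast
          ring_nf
      _ ≤ ε / 2 * 2 ^ L := by gcongr

/-! ### Assembly of the two statements -/

namespace EdgeInteraction

universe u

theorem exists_groundStateApproximation (d z : ℕ) (hd : 0 < d) (Δ c p q : ℝ) (hΔ : 0 < Δ)
    (hc : 1 ≤ c) (hp : 0 ≤ p) (hq : 0 ≤ q) :
    ∃ C : ℝ, 0 < C ∧
      ∀ (V : Type u) [Fintype V] [DecidableEq V] (G : SimpleGraph V) [DecidableRel G.Adj],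
        2 ≤ Fintype.card V → (∀ v, G.degree v ≤ z) →
        ∀ h : EdgeInteraction G d, h.HasGap Δ → h.PolynomialDensityOfStates c p q →
        ∀ ord : Fin (Fintype.card G.edgeSet) ≃ G.edgeSet,
        ∀ ε : ℝ, 0 < ε → ε < 1 →
          ∃ (β : ℝ) (M L D : ℕ), 0 ≤ β ∧ 0 < M ∧
            β ≤ C * Real.log (Fintype.card V / ε) ∧
            (D : ℝ) ≤ Real.exp (C * Real.log (Fintype.card V / ε) ^ 2) ∧
            h.GroundStateApproximation ord ε β M L D := by
  obtain ⟨C, hC, H⟩ := exists_trotter_parameters d z hd Δ c p q hΔ hc hp hq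
  refine ⟨C, hC, ?_⟩
  intro V _ _ G _ hV hdeg h hgap hD ord ε hε hε1
  have : Nonempty V := Fintype.card_pos_iff.1 (by omega)
  have hN2 : (2 : ℝ) ≤ Fintype.card V := Nat.ofNat_le_cast.2 hV
  have hcN : 1 ≤ c * Fintype.card V := by nlinarith
  obtain ⟨β, W, M, L, hβ, hM, h1, h2, h3, h4, h5, h6, h7⟩ := H (Fintype.card V) ε
    (Fintype.card G.edgeSet) hN2 hε hε1 (by exact_mod_cast card_edgeSet_le G hdeg)
  have hexc := h.excitedWeight_le hΔ hp hq hcN hβ hgap hD h3 (by linarith)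
  have hdegen := h.degeneracy_le hD
  refine ⟨β, M, L, bondDim d M L, hβ, hM, h1, le_trans ?_ h2,
    h.groundStateApproximation_of_le hd ord (δ := ε / 2) (W := W) hβ hM (by linarith)
      (by linarith) (by linarith) (by linarith) (by linarith) h5 h6 h7⟩
  exact_mod_cast bondDim_le d M L

end EdgeInteraction

end

theorem mainTheorem3 (d z : ℕ) (hd : 0 < d) (Δ c p q : ℝ) (hΔ : 0 < Δ) (hc : 1 ≤ c)
    (hp : 0 ≤ p) (hq : 0 ≤ q) :
    (∃ C : ℝ, 0 < C ∧
      ∀ (V : Type*) [Fintype V] [DecidableEq V] (G : SimpleGraph V) [DecidableRel G.Adj],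
        G.Connected → (∀ v, G.degree v ≤ z) →
        ∀ h : EdgeInteraction G d, h.HasGap Δ → h.PolynomialDensityOfStates c p q →
        ∀ ord : Fin (Fintype.card G.edgeSet) ≃ G.edgeSet,
        ∀ ε : ℝ, 0 < ε → ε < 1 →
          ∃ (β : ℝ) (M L D : ℕ), 0 ≤ β ∧ 0 < M ∧
            β ≤ C * Real.log (Fintype.card V / ε) ∧
            (D : ℝ) ≤ Real.exp (C * Real.log (Fintype.card V / ε) ^ 2) ∧
            h.GroundStateApproximation ord ε β M L D) ∧
    (∀ a k : ℝ, 0 < a → 0 ≤ k → ∃ C : ℝ, 0 < C ∧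
      ∀ (V : Type*) [Fintype V] [DecidableEq V] (G : SimpleGraph V) [DecidableRel G.Adj],
        G.Connected → (∀ v, G.degree v ≤ z) →
        ∀ h : EdgeInteraction G d, h.HasGap Δ → h.PolynomialDensityOfStates c p q →
        ∀ ord : Fin (Fintype.card G.edgeSet) ≃ G.edgeSet,
        ∀ ε : ℝ, a * (Fintype.card V : ℝ) ^ (-k) ≤ ε →
          ∃ (β : ℝ) (M L D : ℕ), 0 ≤ β ∧ 0 < M ∧
            β ≤ C * Real.log (Fintype.card V) ∧
            (D : ℝ) ≤ (Fintype.card V : ℝ) ^ (C * Real.log (Fintype.card V)) ∧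
            h.GroundStateApproximation ord ε β M L D) := by
  have hbond : ((EdgeInteraction.bondDim d 1 0 : ℕ) : ℝ) ≤ 1 := by
    have := EdgeInteraction.bondDim_le d 1 0
    rw [mul_zero, pow_zero] at this
    exact_mod_cast this
  constructor
  · obtain ⟨C, hC, H⟩ := EdgeInteraction.exists_groundStateApproximation d z hd Δ c p q hΔ hc hp hq
    refine ⟨C, hC, ?_⟩
    intro V _ _ G _ hG hdeg h hgap hD ord ε hε hε1
    have hpos : 0 < Fintype.card V := Fintype.card_pos_iff.2 hG.nonempty
    -- On one vertex $\log(N/\varepsilon)$ has no positive lower bound, so constants cannot be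
    -- absorbed into it; there $\beta=0$ and $D\le1$ already work.
    rcases Nat.lt_or_ge (Fintype.card V) 2 with hV | hV
    · have hV1 : Fintype.card V = 1 := by omega
      refine ⟨0, 1, 0, _, le_rfl, one_pos, ?_, ?_,
        h.groundStateApproximation_of_card_eq_one hd hV1 ord hε⟩
      · rw [hV1, Nat.cast_one]
        exact mul_nonneg hC.le (Real.log_nonneg (by rw [le_div_iff₀ hε]; linarith))
      · exact hbond.trans (Real.one_le_exp (by positivity))
    · exact H V G hV hdeg h hgap hD ord ε hε hε1
  · intro a k ha hk
    obtain ⟨C, hC, H⟩ := EdgeInteraction.exists_groundStateApproximation d z hd Δ c p q hΔ hc hp hq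
    have hlog2 : 0 < Real.log 2 := Real.log_pos one_lt_two
    have ha2 : 1 ≤ a⁻¹ + 2 := by linarith [inv_pos.2 ha]
    -- Chosen so that $\log(N/\varepsilon')\le C'\log N$: the `1` is for $N$, `k` for $N^k$, and
    -- $a^{-1}+2$ dominates both alternatives in the minimum defining `ε'`, its logarithm being
    -- absorbed by $N\ge2$.
    set C' := 1 + k + Real.log (a⁻¹ + 2) / Real.log 2 with hC'
    have hC'0 : 0 ≤ C' := by
      have := Real.log_nonneg ha2
      positivity
    refine ⟨C + C * C' + C * C' ^ 2, by positivity, ?_⟩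
    intro V _ _ G _ hG hdeg h hgap hD ord ε hε
    have hpos : 0 < Fintype.card V := Fintype.card_pos_iff.2 hG.nonempty
    rcases Nat.lt_or_ge (Fintype.card V) 2 with hV | hV
    · have hV1 : Fintype.card V = 1 := by omega
      have hε0 : 0 < ε := by
        rw [hV1, Nat.cast_one, Real.one_rpow, mul_one] at hε
        linarith
      refine ⟨0, 1, 0, _, le_rfl, one_pos, ?_, ?_,
        h.groundStateApproximation_of_card_eq_one hd hV1 ord hε0⟩
      · simp [hV1]
      · simpa [hV1] using hbond
    · set N : ℝ := (Fintype.card V : ℝ) with hN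
      have hN2 : 2 ≤ N := Nat.ofNat_le_cast.2 hV
      have hN0 : 0 < N := by linarith
      -- The minimum with `1 / 2` ensures `ε' < 1`, which $aN^{-k}$ alone need not satisfy; the
      -- result for `ε'` passes to `ε` by monotonicity.
      set ε' := min (a * N ^ (-k)) (1 / 2) with hε'
      have hε'0 : 0 < ε' := by positivity
      have hε'1 : ε' < 1 := (min_le_right _ _).trans_lt (by norm_num)
      obtain ⟨β, M, L, D, h1, h2, h3, h4, h5⟩ := H V G hV hdeg h hgap hD ord ε' hε'0 hε'1
      have hlogN : 0 ≤ Real.log N := Real.log_nonneg (by linarith)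
      have hNε0 : 0 ≤ Real.log (N / ε') :=
        Real.log_nonneg (by rw [le_div_iff₀ hε'0]; linarith)
      have hinv : ε'⁻¹ ≤ N ^ k * (a⁻¹ + 2) := by
        have hNk : 1 ≤ N ^ k := Real.one_le_rpow (by linarith) hk
        have hainv : 0 < a⁻¹ := inv_pos.2 ha
        rcases min_choice (a * N ^ (-k)) (1 / 2) with hmin | hmin
        · rw [hε', hmin, mul_inv, Real.rpow_neg hN0.le, inv_inv]
          nlinarith
        · rw [hε', hmin]
          norm_num
          nlinarith
      have hlog : Real.log (N / ε') ≤ C' * Real.log N := by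
        rw [div_eq_mul_inv, Real.log_mul hN0.ne' (inv_pos.2 hε'0).ne']
        have e1 : Real.log ε'⁻¹ ≤ k * Real.log N + Real.log (a⁻¹ + 2) := by
          refine (Real.log_le_log (inv_pos.2 hε'0) hinv).trans_eq ?_
          rw [Real.log_mul (Real.rpow_pos_of_pos hN0 k).ne' (by linarith), Real.log_rpow hN0]
        have e2 : Real.log (a⁻¹ + 2) ≤ Real.log (a⁻¹ + 2) / Real.log 2 * Real.log N := by
          rw [div_mul_eq_mul_div, le_div_iff₀ hlog2]
          exact mul_le_mul_of_nonneg_left (Real.log_le_log two_pos hN2) (Real.log_nonneg ha2)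
        rw [hC']
        linarith
      refine ⟨β, M, L, D, h1, h2, h3.trans ?_, h4.trans ?_,
        h5.mono ((min_le_left _ _).trans hε)⟩
      · calc C * Real.log (N / ε') ≤ C * (C' * Real.log N) := by gcongr
          _ = C * C' * Real.log N := by ring
          _ ≤ _ := by
            gcongr
            have : 0 ≤ C * C' ^ 2 := by positivity
            linarith
      · rw [Real.rpow_def_of_pos hN0, Real.exp_le_exp]
        calc C * Real.log (N / ε') ^ 2 ≤ C * (C' * Real.log N) ^ 2 := by gcongr
          _ = Real.log N * (C * C' ^ 2 * Real.log N) := by ring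
          _ ≤ _ := by
            gcongr
            have : 0 ≤ C * C' := by positivity
            linarith
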